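/- Corollary (strong Main Conjecture in rank $\le 2$). Let $W$ be a nontrivial finite real reflection group acting irreducibly and orthogonally on a Euclidean space $E$ of dimension $n\le 2$ (so $W$ is $A_1$ or a dihedral group $I_2(m)$, $m\ge 3$). Let $c$ be a Coxeter element of $W$ (the product, in any order, of the reflections in the walls of a chamber), let $h$ be its order, $C=\langle c\rangle$ and $\omega=e^{2\pi i/h}$. Let $V=\mathbb C\otimes E$, let $x_1,\dots,x_n$ be a basis of $V^*$, and identify $\mathbb C[V]=\mathbb C[x_1,\dots,x_n]$. Let $\Theta=(\theta_1,\dots,\theta_n)$ be any homogeneous system of parameters of degree $h+1$ in $\mathbb C[V]$ such that the linear map $V^*\to\mathbb C[V]$, $x_i\mapsto\theta_i$, is $W$-equivariant. Let $V^\Theta\subseteq V$ be the zero locus of the ideal $(\Theta-\mathbf x)=(\theta_1-x_1,\dots,\theta_n-x_n)$, with the action of $W\times C$ in which $W$ acts linearly and $c$ acts as multiplication by $\omega$. Let $\mathcal L$ be the set of flats (intersections of reflecting hyperplanes in $E$, including $E$ itself). Let $\ell_T(w)$ be the least number of reflections of $W$ with product $w$, and write $u\le_T v$ if $\ell_T(v)=\ell_T(u)+\ell_T(u^{-1}v)$.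 A flat is called noncrossing if it is the fixed space $E^u$ of some $u\in W$ with $u\le_T c$. For $w\in W$ and $X\in\mathcal L$ let $[w,X]$ be the class of $(w,X)$ under the equivalence relation $(w,X)\sim(w',X')\iff X=X'$ and $wW_X=w'W_X$, where $W_X$ is the pointwise stabilizer of $X$. Let $\mathrm{Park}^{NC}_W$ be the set of classes $[w,X]$ with $w\in W$ and $X$ noncrossing, with the action $(v,c^d).[w,X]=[vwc^{-d},c^d(X)]$ of $W\times C$. Then $V^\Theta$ consists of exactly $(h+1)^n$ distinct points, they are reduced (that is, the ring $\mathbb C[V]/(\Theta-\mathbf x)$ is reduced), and there is a $W\times C$-equivariant bijection between $V^\Theta$ and $\mathrm{Park}^{NC}_W$. -/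

import Mathlib

open scoped TensorProduct

namespace ParkingSpace

variable {E : Type*} [NormedAddCommGroup E] [InnerProductSpace ℝ E]

/-! ### Real reflection groups -/

/-- The hyperplane `H_α` orthogonal to `α`. -/
noncomputable def hyperplane (α : E) : Submodule ℝ E := (ℝ ∙ α)ᗮ

/-- The orthogonal reflection `t_α` in the hyperplane `H_α`. -/
noncomputable def refl (α : E) : E ≃ₗᵢ[ℝ] E := (ℝ ∙ α)ᗮ.reflection

/-- The root system `Φ` of `W`: the unit normals to the hyperplanes of the reflections in `W`. -/
def roots (W : Subgroup (E ≃ₗᵢ[ℝ] E)) : Set E := {α | ‖α‖ = 1 ∧ refl α ∈ W}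

/-- A finite group of isometries of `E`, generated by reflections and acting irreducibly. The trivial
group (which has rank `0`, but acts irreducibly on a line) is excluded. -/
structure IsIrreducibleReflectionGroup (W : Subgroup (E ≃ₗᵢ[ℝ] E)) : Prop where
  finite : Finite W
  generated : Subgroup.closure (refl '' roots W) = W
  nontrivial : Nontrivial W
  space_nontrivial : Nontrivial E
  irreducible : ∀ U : Submodule ℝ E, (∀ w ∈ W, ∀ u ∈ U, w u ∈ U) → U = ⊥ ∨ U = ⊤

/-- The complement of the reflecting hyperplanes. -/
def regularSet (W : Subgroup (E ≃ₗᵢ[ℝ] E)) : Set E :=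
  (⋃ α ∈ roots W, (hyperplane α : Set E))ᶜ

/-- Chambers: the connected components of the complement of the reflecting hyperplanes. -/
def IsChamber (W : Subgroup (E ≃ₗᵢ[ℝ] E)) (D : Set E) : Prop :=
  ∃ x ∈ regularSet W, D = connectedComponentIn (regularSet W) x

/-- The positive roots with respect to a chamber `D`. -/
def positiveRoots (W : Subgroup (E ≃ₗᵢ[ℝ] E)) (D : Set E) : Set E :=
  {α ∈ roots W | ∀ x ∈ D, 0 < inner ℝ α x}

/-- The simple roots with respect to a chamber `D`: the positive roots whose hyperplane bounds `D`,
that is, is spanned by its intersection with the closure of `D`. -/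
def simpleRoots (W : Subgroup (E ≃ₗᵢ[ℝ] E)) (D : Set E) : Set E :=
  {α ∈ positiveRoots W D |
    Submodule.span ℝ ((hyperplane α : Set E) ∩ closure D) = hyperplane α}

/-- Coxeter elements: the products, in any order, of the simple reflections of a chamber. -/
def IsCoxeterElement (W : Subgroup (E ≃ₗᵢ[ℝ] E)) (c : W) : Prop :=
  ∃ D : Set E, IsChamber W D ∧ ∃ l : List E, l.Nodup ∧ (∀ α, α ∈ l ↔ α ∈ simpleRoots W D) ∧
    (c : E ≃ₗᵢ[ℝ] E) = (l.map refl).prod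

/-! ### Noncrossing flats -/

/-- The set `T` of reflections of `W`. -/
def IsReflection (W : Subgroup (E ≃ₗᵢ[ℝ] E)) (t : W) : Prop :=
  ∃ α ∈ roots W, (t : E ≃ₗᵢ[ℝ] E) = refl α

/-- The reflection length `ℓ_T`. -/
noncomputable def reflectionLength (W : Subgroup (E ≃ₗᵢ[ℝ] E)) (w : W) : ℕ :=
  sInf {k | ∃ l : List W, l.length = k ∧ (∀ t ∈ l, IsReflection W t) ∧ l.prod = w}

/-- The absolute order `u ≤_T v`. -/
def AbsLE (W : Subgroup (E ≃ₗᵢ[ℝ] E)) (u v : W) : Prop :=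
  reflectionLength W v = reflectionLength W u + reflectionLength W (u⁻¹ * v)

/-- The fixed space `V^w`. -/
def fixedSpace (W : Subgroup (E ≃ₗᵢ[ℝ] E)) (w : W) : Submodule ℝ E where
  carrier := {v | (w : E ≃ₗᵢ[ℝ] E) v = v}
  add_mem' := by
    intro a b ha hb
    simp only [Set.mem_ofPred_eq, map_add] at *
    rw [ha, hb]
  zero_mem' := by simp
  smul_mem' := by
    intro r a ha
    simp only [Set.mem_ofPred_eq, map_smul] at *
    rw [ha]

/-- Flats: the intersections of reflecting hyperplanes (the empty intersection is `E`). -/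
def IsFlat (W : Subgroup (E ≃ₗᵢ[ℝ] E)) (X : Submodule ℝ E) : Prop :=
  ∃ S ⊆ roots W, X = ⨅ α ∈ S, hyperplane α

/-- The lattice `ℒ` of flats, as a type. -/
abbrev Flat (W : Subgroup (E ≃ₗᵢ[ℝ] E)) : Type _ := {X : Submodule ℝ E // IsFlat W X}

/-- Noncrossing flats with respect to `c`: the fixed spaces of the elements of `[1, c]_T`. -/
def IsNoncrossing (W : Subgroup (E ≃ₗᵢ[ℝ] E)) (c : W) (X : Submodule ℝ E) : Prop :=
  ∃ u : W, AbsLE W u c ∧ X = fixedSpace W u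

/-- The image `u(X)` of a subspace. -/
def image (W : Subgroup (E ≃ₗᵢ[ℝ] E)) (u : W) (X : Submodule ℝ E) : Submodule ℝ E :=
  X.map ((u : E ≃ₗᵢ[ℝ] E).toLinearEquiv : E →ₗ[ℝ] E)

/-- The pointwise stabilizer `W_X`. -/
def pointwiseStabilizer (W : Subgroup (E ≃ₗᵢ[ℝ] E)) (X : Submodule ℝ E) : Subgroup W where
  carrier := {w | ∀ x ∈ X, (w : E ≃ₗᵢ[ℝ] E) x = x}
  mul_mem' := by
    intro a b ha hb x hx
    change (a : E ≃ₗᵢ[ℝ] E) ((b : E ≃ₗᵢ[ℝ] E) x) = x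
    rw [hb x hx, ha x hx]
  one_mem' := by intro x _; rfl
  inv_mem' := by
    intro a ha x hx
    change (a : E ≃ₗᵢ[ℝ] E).symm x = x
    rw [LinearIsometryEquiv.symm_apply_eq, ha x hx]

variable (W : Subgroup (E ≃ₗᵢ[ℝ] E))

theorem mem_image {u : W} {X : Submodule ℝ E} {y : E} :
    y ∈ image W u X ↔ (u : E ≃ₗᵢ[ℝ] E).symm y ∈ X := by
  constructor
  · rintro ⟨x, hx, rfl⟩
    simpa using hx
  · intro h
    exact ⟨_, h, by simp⟩

theorem refl_apply_eq (u : E ≃ₗᵢ[ℝ] E) (α : E) : refl (u α) = u * refl α * u⁻¹ := by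
  have h := Submodule.reflection_map u (ℝ ∙ α)ᗮ
  have h2 : ((ℝ ∙ α)ᗮ).map (u.toLinearEquiv : E →ₗ[ℝ] E) = (ℝ ∙ (u α))ᗮ := by
    ext y
    simp only [Submodule.mem_map, Submodule.mem_orthogonal_singleton_iff_inner_right]
    constructor
    · rintro ⟨x, hx, rfl⟩
      simpa using hx
    · intro hy
      refine ⟨u.symm y, ?_, by simp⟩
      rw [← u.inner_map_map]
      simpa using hy
  unfold refl
  ext y
  have h3 := congrArg (fun r : E ≃ₗᵢ[ℝ] E => r y) h
  simp only [h2] at h3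
  exact h3

theorem roots_map (u : W) {α : E} (hα : α ∈ roots W) : (u : E ≃ₗᵢ[ℝ] E) α ∈ roots W := by
  refine ⟨by simpa using hα.1, ?_⟩
  rw [refl_apply_eq]
  exact W.mul_mem (W.mul_mem u.2 hα.2) (W.inv_mem u.2)

theorem isFlat_image (u : W) {X : Submodule ℝ E} (hX : IsFlat W X) : IsFlat W (image W u X) := by
  obtain ⟨S, hS, rfl⟩ := hX
  refine ⟨(u : E ≃ₗᵢ[ℝ] E) '' S, ?_, ?_⟩
  · rintro _ ⟨α, hα, rfl⟩
    exact roots_map W u (hS hα)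
  · ext y
    simp only [mem_image, Submodule.mem_iInf, hyperplane,
      Submodule.mem_orthogonal_singleton_iff_inner_right, Set.forall_mem_image]
    refine forall₂_congr fun α _ => ?_
    rw [← (u : E ≃ₗᵢ[ℝ] E).inner_map_map, LinearIsometryEquiv.apply_symm_apply]

theorem image_one (X : Submodule ℝ E) : image W 1 X = X := by
  ext y; rw [mem_image]; rfl

theorem image_mul (u v : W) (X : Submodule ℝ E) :
    image W (u * v) X = image W u (image W v X) := by
  ext y; rw [mem_image, mem_image, mem_image]; rfl

/-! ### Noncrossing parking functions -/

/-- The equivalence `(w, X) ∼ (w', X')`: `X = X'` and `w W_X = w' W_X`. -/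
def parkSetoid : Setoid (W × Flat W) where
  r p q := p.2 = q.2 ∧
    (QuotientGroup.mk p.1 : W ⧸ pointwiseStabilizer W p.2.1) = QuotientGroup.mk q.1
  iseqv := by
    refine ⟨fun _ => ⟨rfl, rfl⟩, ?_, ?_⟩
    · rintro ⟨w, X⟩ ⟨w', X'⟩ ⟨h, h'⟩
      obtain rfl : X = X' := h
      exact ⟨rfl, h'.symm⟩
    · rintro ⟨w, X⟩ ⟨w', X'⟩ ⟨w'', X''⟩ ⟨h, h'⟩ ⟨k, k'⟩
      obtain rfl : X = X' := h
      obtain rfl : X = X'' := k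
      exact ⟨rfl, h'.trans k'⟩

/-- The set `(W × ℒ)/∼`. -/
def ParkAll : Type _ := Quotient (parkSetoid W)

/-- The class `[w, X]`. -/
def ParkAll.mk (w : W) (X : Flat W) : ParkAll W := Quotient.mk (parkSetoid W) (w, X)

/-- The map `[w, X] ↦ [v w u⁻¹, u(X)]`. -/
def ParkAll.act (v u : W) : ParkAll W → ParkAll W :=
  Quotient.map' (s₁ := parkSetoid W) (s₂ := parkSetoid W)
    (fun p => (v * p.1 * u⁻¹, ⟨image W u p.2.1, isFlat_image W u p.2.2⟩)) (by
      rintro ⟨w, X⟩ ⟨w', X'⟩ ⟨h, h'⟩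
      obtain rfl : X = X' := h
      refine ⟨rfl, ?_⟩
      rw [QuotientGroup.eq] at h' ⊢
      intro x hx
      have hx' := (mem_image W).1 hx
      have h2 := h' _ hx'
      have e : (v * w * u⁻¹)⁻¹ * (v * w' * u⁻¹) = u * (w⁻¹ * w') * u⁻¹ := by group
      change (((v * w * u⁻¹)⁻¹ * (v * w' * u⁻¹) : W) : E ≃ₗᵢ[ℝ] E) x = x
      rw [e]
      change (u : E ≃ₗᵢ[ℝ] E) (((w⁻¹ * w' : W) : E ≃ₗᵢ[ℝ] E) ((u : E ≃ₗᵢ[ℝ] E).symm x)) = x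
      rw [h2, LinearIsometryEquiv.apply_symm_apply])

/-- The action of `W × C` on `(W × ℒ)/∼`, where `C = ⟨c⟩`:
`(v, u).[w, X] = [v w u⁻¹, u(X)]` for `u = c ^ d`. -/
instance parkAction (c : W) : MulAction (W × Subgroup.zpowers c) (ParkAll W) where
  smul g p := ParkAll.act W g.1 g.2 p
  one_smul p := by
    refine Quotient.inductionOn' p ?_
    rintro ⟨w, X⟩
    change ParkAll.mk W (1 * w * (1 : W)⁻¹) ⟨image W 1 X.1, _⟩ = ParkAll.mk W w X
    simp only [image_one, one_mul, inv_one, mul_one]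
  mul_smul g k p := by
    refine Quotient.inductionOn' p ?_
    rintro ⟨w, X⟩
    change ParkAll.mk W ((g.1 * k.1) * w * ((g.2 : W) * (k.2 : W))⁻¹)
        ⟨image W ((g.2 : W) * (k.2 : W)) X.1, _⟩ =
      ParkAll.mk W (g.1 * (k.1 * w * (k.2 : W)⁻¹) * (g.2 : W)⁻¹)
        ⟨image W (g.2 : W) (image W (k.2 : W) X.1), _⟩
    simp only [image_mul, mul_inv_rev, mul_assoc]

theorem isReflection_conj (u : W) {t : W} (ht : IsReflection W t) :
    IsReflection W (u * t * u⁻¹) := by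
  obtain ⟨α, hα, h⟩ := ht
  refine ⟨_, roots_map W u hα, ?_⟩
  rw [refl_apply_eq, ← h]
  rfl

theorem reflectionLength_conj (u w : W) :
    reflectionLength W (u * w * u⁻¹) = reflectionLength W w := by
  have key : ∀ (u w : W) (k : ℕ),
      (∃ l : List W, l.length = k ∧ (∀ t ∈ l, IsReflection W t) ∧ l.prod = w) →
      ∃ l : List W, l.length = k ∧ (∀ t ∈ l, IsReflection W t) ∧ l.prod = u * w * u⁻¹ := by
    rintro u w k ⟨l, hl, ht, hp⟩
    refine ⟨l.map (MulAut.conj u), by simpa using hl, ?_, ?_⟩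
    · intro t hm
      obtain ⟨s, hs, rfl⟩ := List.mem_map.1 hm
      exact isReflection_conj W u (ht s hs)
    · rw [← map_list_prod, hp]
      rfl
  unfold reflectionLength
  congr 1
  ext k
  refine ⟨fun h => ?_, key u w k⟩
  have h2 := key u⁻¹ _ k h
  have e : u⁻¹ * (u * w * u⁻¹) * u⁻¹⁻¹ = w := by group
  rwa [e] at h2

theorem fixedSpace_conj (u w : W) : fixedSpace W (u * w * u⁻¹) = image W u (fixedSpace W w) := by
  ext y
  rw [mem_image]
  change (u : E ≃ₗᵢ[ℝ] E) ((w : E ≃ₗᵢ[ℝ] E) ((u : E ≃ₗᵢ[ℝ] E).symm y)) = y ↔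
    (w : E ≃ₗᵢ[ℝ] E) ((u : E ≃ₗᵢ[ℝ] E).symm y) = (u : E ≃ₗᵢ[ℝ] E).symm y
  rw [← LinearIsometryEquiv.eq_symm_apply]

theorem isNoncrossing_image (c : W) (u : Subgroup.zpowers c) {X : Submodule ℝ E}
    (hX : IsNoncrossing W c X) : IsNoncrossing W c (image W u X) := by
  obtain ⟨w, hw, rfl⟩ := hX
  refine ⟨u * w * (u : W)⁻¹, ?_, (fixedSpace_conj W _ _).symm⟩
  obtain ⟨u, d, rfl⟩ := u
  have e : (c ^ d * w * (c ^ d)⁻¹)⁻¹ * c = c ^ d * (w⁻¹ * c) * (c ^ d)⁻¹ := by group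
  unfold AbsLE at *
  change reflectionLength W c = reflectionLength W (c ^ d * w * (c ^ d)⁻¹) +
    reflectionLength W ((c ^ d * w * (c ^ d)⁻¹)⁻¹ * c)
  rw [e, reflectionLength_conj, reflectionLength_conj, hw]

/-- The `W × C`-set of noncrossing parking functions: the classes `[w, X]` with `w` in `W` and `X` a
noncrossing flat. -/
def parkNC (c : W) : SubMulAction (W × Subgroup.zpowers c) (ParkAll W) where
  carrier := {p | ∃ (w : W) (X : Flat W), IsNoncrossing W c X.1 ∧ p = ParkAll.mk W w X}
  smul_mem' := by
    rintro g _ ⟨w, X, hX, rfl⟩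
    exact ⟨g.1 * w * (g.2 : W)⁻¹, ⟨image W g.2 X.1, isFlat_image W g.2 X.2⟩,
      isNoncrossing_image W c g.2 hX, rfl⟩

/-! ### The algebraic side -/

/-- The action of `W` on the complexification `V = ℂ ⊗ E`. -/
noncomputable def complexAct (w : W) : ℂ ⊗[ℝ] E →ₗ[ℂ] ℂ ⊗[ℝ] E :=
  LinearMap.baseChange ℂ ((w : E ≃ₗᵢ[ℝ] E).toLinearEquiv : E →ₗ[ℝ] E)

/-- The contragredient action of `W` on `V*`. -/
noncomputable def dualAct (w : W) (f : Module.Dual ℂ (ℂ ⊗[ℝ] E)) : Module.Dual ℂ (ℂ ⊗[ℝ] E) :=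
  f ∘ₗ complexAct W w⁻¹

variable {n : ℕ} (x : Module.Basis (Fin n) ℂ (Module.Dual ℂ (ℂ ⊗[ℝ] E)))

/-- The inclusion `V* → ℂ[V] = ℂ[x₁, …, xₙ]` for a basis `x₁, …, xₙ` of `V*`. -/
noncomputable def linearForm : Module.Dual ℂ (ℂ ⊗[ℝ] E) →ₗ[ℂ] MvPolynomial (Fin n) ℂ :=
  x.constr ℂ MvPolynomial.X

/-- The action of `W` on `ℂ[V]` by linear substitutions. -/
noncomputable def polyAct (w : W) : MvPolynomial (Fin n) ℂ →ₐ[ℂ] MvPolynomial (Fin n) ℂ :=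
  MvPolynomial.aeval fun i => linearForm x (dualAct W w (x i))

/-- `Θ = (θ₁, …, θₙ)` is a homogeneous system of parameters of degree `k` in `ℂ[V]` such that the
linear map `V* → ℂ[V]` with `xᵢ ↦ θᵢ` is `W`-equivariant. -/
structure IsAdmissibleHsop (θ : Fin n → MvPolynomial (Fin n) ℂ) (k : ℕ) : Prop where
  homogeneous : ∀ i, (θ i).IsHomogeneous k
  finite_quotient : Module.Finite ℂ (MvPolynomial (Fin n) ℂ ⧸ Ideal.span (Set.range θ))
  equivariant : ∀ w : W, ∀ f : Module.Dual ℂ (ℂ ⊗[ℝ] E),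
    x.constr ℂ θ (dualAct W w f) = polyAct W x w (x.constr ℂ θ f)

/-- The ideal `(Θ - 𝐱) = (θ₁ - x₁, …, θₙ - xₙ)`. -/
noncomputable def deformedIdeal (θ : Fin n → MvPolynomial (Fin n) ℂ) :
    Ideal (MvPolynomial (Fin n) ℂ) :=
  Ideal.span (Set.range fun i => θ i - MvPolynomial.X i)

/-- The value at a point `v` of `V` of a polynomial in the coordinate functions `x₁, …, xₙ`. -/
noncomputable def evalAt (v : ℂ ⊗[ℝ] E) (p : MvPolynomial (Fin n) ℂ) : ℂ :=
  MvPolynomial.eval (fun i => x i v) p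

/-- The zero locus `V^Θ` in `V` of the ideal `(Θ - 𝐱)`. -/
def variety (θ : Fin n → MvPolynomial (Fin n) ℂ) : Set (ℂ ⊗[ℝ] E) :=
  {v | ∀ p ∈ deformedIdeal θ, evalAt x v p = 0}

/-- The scalar `ω = exp (2πi/h)` by which the generator `c` of `C` acts on `V`, where `h` is the
order of `c`. -/
noncomputable def omega (c : W) : ℂ := Complex.exp (2 * Real.pi * Complex.I / (orderOf c : ℂ))

end ParkingSpace

/-! A map of the form `[w, X] ↦ w q(X)` is determined by one point `q(X)` of `V` for each
noncrossing flat. It is well defined if `W_X` fixes `q(X)`, and it respects `C` as soon as `q(c X) =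
ω • c q(X)`; `exists_equivariant_equiv` turns such a choice into the required bijection. It remains
to solve `Θ = 𝐱` explicitly and to select the points.

In rank 1, `W = {±1}`, `h = 2` and `θ = a x³`. The solutions are `0, p, -p`; the zero flat gets `0`
and the whole line gets `p`.

In rank 2, chamber geometry shows that `c` is a rotation by `2π/h` in a dihedral group, with `h ≥ 3`
(`exists_dihedral_form`). Nothing depends on the basis of `V*`, so one may use eigencoordinates `u,
w`, in which `c` acts by `(ω, ω⁻¹)` and a reflection `t` swaps the two. Equivariance leaves `θ₀ = A
u^(h+1) + B u^(k+1) w^k + C u w^h`, with `k = h/2` and `B = 0` for odd `h`; `θ₁` is its mirror image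
(`exists_theta_form`). Since `Θ` vanishes only at the origin, `A ≠ 0`, `A ≠ C`, and `A + C + B η^k ≠
0` whenever `η^h = 1` (`theta_nondegenerate`). The solutions are then the origin, `h` points on each
axis, and `h` points on each line `u = η w` (`solution_iff`), in all `1 + 2h + h² = (h+1)²`. The
Jacobian determinant is nonzero at each of them (`jacobian_ne_zero`), whence reducedness by
`isReduced_of_jacobian`.

The noncrossing flats are the plane, the origin and all reflecting lines
(`noncrossing_classification`), and the lines `u = η w` are the complexified reflecting lines. The
plane gets a point `(0, a)` on the axis where `c` acts by `ω⁻¹`, so that `ω c` fixes it. The line of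
`η` gets `(η y, y)`, where `y` depends on `η` only through `B η^k` and so is constant along the
`c`-orbit `η ↦ ω² η`. -/

namespace ParkingSpace

/-! ### The Jacobian criterion for reducedness -/

section Jacobian

/-- For a nonzero nilpotent `r`, a maximal ideal `M` containing its annihilator is finitely
generated and idempotent, hence generated by an idempotent `e`. As `r ∈ M`, `1 - e` kills `r`, so
`M` contains both `e` and `1 - e`. -/
theorem isReduced_of_isMaximal_le_sq {R : Type*} [CommRing R] [IsNoetherianRing R]
    (h : ∀ M : Ideal R, M.IsMaximal → M ≤ M * M) : IsReduced R := by
  refine ⟨fun r hr => ?_⟩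
  by_contra hr0
  let A : Ideal R := LinearMap.ker (LinearMap.toSpanSingleton R R r)
  have hA : ∀ a, a ∈ A ↔ a * r = 0 := fun a => by simp [A]
  have hAtop : A ≠ ⊤ := by
    rw [Ideal.ne_top_iff_one, hA, one_mul]
    exact hr0
  obtain ⟨M, hM, hAM⟩ := Ideal.exists_le_maximal A hAtop
  obtain ⟨e, he, hMe⟩ := (Ideal.isIdempotentElem_iff_of_fg M (IsNoetherian.noetherian M)).1
    (le_antisymm Ideal.mul_le_left (h M hM))
  have hrM : r ∈ M := by
    obtain ⟨k, hk⟩ := hr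
    exact hM.isPrime.mem_of_pow_mem k (hk ▸ M.zero_mem)
  rw [hMe] at hrM
  obtain ⟨s, rfl⟩ := Ideal.mem_span_singleton'.1 hrM
  have h1 : 1 - e ∈ M := hAM <| (hA _).2 <| by
    have : e * e = e := he
    linear_combination (-s) * this
  have h2 : e ∈ M := hMe ▸ Ideal.mem_span_singleton_self e
  exact hM.ne_top ((Ideal.eq_top_iff_one _).2 (by simpa using M.add_mem h1 h2))

open MvPolynomial in
-- First-order Taylor expansion at `p`. The only inductive case with content writes `X j` as `p j`
-- plus an element of `N`.
theorem taylor_mem_sq {K σ : Type*} [Field K] [Fintype σ] (p : σ → K)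
    (N : Ideal (MvPolynomial σ K)) (hN : ∀ i, X i - C (p i) ∈ N) (g : MvPolynomial σ K) :
    g - C (eval p g) - ∑ i, C (eval p (pderiv i g)) * (X i - C (p i)) ∈ N * N := by
  classical
  induction g using MvPolynomial.induction_on with
  | C a => simp
  | add f g hf hg =>
    convert (N * N).add_mem hf hg using 1
    simp only [map_add, add_mul, Finset.sum_add_distrib]
    ring
  | mul_X g j hg =>
    have h1 : g - C (eval p g) ∈ N := by
      have h2 := Ideal.mul_le_left hg
      have h3 : ∑ i, C (eval p (pderiv i g)) * (X i - C (p i)) ∈ N :=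
        N.sum_mem fun i _ => N.mul_mem_left _ (hN i)
      simpa using N.add_mem h2 h3
    have h4 := (N * N).add_mem ((N * N).mul_mem_left (C (p j)) hg)
      (Ideal.mul_mem_mul h1 (hN j))
    convert h4 using 1
    have h5 : ∑ i, C (eval p (pderiv i (g * X j))) * (X i - C (p i)) =
        C (p j) * (∑ i, C (eval p (pderiv i g)) * (X i - C (p i))) +
          C (eval p g) * (X j - C (p j)) := by
      have h6 : ∀ i, C (eval p (pderiv i (g * X j))) * (X i - C (p i)) =
          C (p j) * (C (eval p (pderiv i g)) * (X i - C (p i))) +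
            if i = j then C (eval p g) * (X j - C (p j)) else 0 := by
        intro i
        rw [Derivation.leibniz, pderiv_X, Pi.single_apply]
        by_cases h : i = j
        · subst h
          simp
          ring
        · rw [if_neg h, if_neg (Ne.symm h)]
          simp
          ring
      rw [Finset.sum_congr rfl fun i _ => h6 i, Finset.sum_add_distrib, ← Finset.mul_sum]
      simp
    rw [h5]
    simp only [map_mul, eval_X]
    ring

open MvPolynomial in
-- By the Nullstellensatz a maximal ideal of the quotient comes from a common zero `p`. Inverting
-- the Jacobian matrix at `p` puts each `X i - C (p i)` in `I ⊔ N * N`, so `N` equals its square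
-- modulo `I`.
theorem isReduced_of_jacobian {K σ : Type*} [Field K] [IsAlgClosed K] [Fintype σ] [DecidableEq σ]
    (g : σ → MvPolynomial σ K)
    (h : ∀ p : σ → K, (∀ i, eval p (g i) = 0) →
      (Matrix.of fun i j => eval p (pderiv j (g i))).det ≠ 0) :
    IsReduced (MvPolynomial σ K ⧸ Ideal.span (Set.range g)) := by
  set I := Ideal.span (Set.range g) with hI
  refine isReduced_of_isMaximal_le_sq fun M hM => ?_
  set N := M.comap (Ideal.Quotient.mk I) with hN
  have hNM : N.IsMaximal := Ideal.comap_isMaximal_of_surjective _ Ideal.Quotient.mk_surjective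
  obtain ⟨p, hp⟩ := (isMaximal_iff_eq_vanishingIdeal_singleton (K := K)).1 hNM
  have hmem : ∀ f, f ∈ N ↔ eval p f = 0 := fun f => by
    rw [hp, mem_vanishingIdeal_singleton_iff]; rfl
  have hX : ∀ i, X i - C (p i) ∈ N := fun i => by rw [hmem]; simp
  have hIN : I ≤ N := fun f hf => by
    rw [hN, Ideal.mem_comap, Ideal.Quotient.eq_zero_iff_mem.2 hf]
    exact M.zero_mem
  have hgI : ∀ i, g i ∈ I := fun i => Ideal.subset_span ⟨i, rfl⟩
  have hg0 : ∀ i, eval p (g i) = 0 := fun i => (hmem _).1 (hIN (hgI i))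
  set J := Matrix.of fun i j => eval p (pderiv j (g i)) with hJ
  have hdet : IsUnit J.det := isUnit_iff_ne_zero.2 (h p hg0)
  have hlin : ∀ i, ∑ j, C (J i j) * (X j - C (p j)) ∈ I ⊔ N * N := fun i => by
    have h1 := taylor_mem_sq p N hX (g i)
    rw [hg0] at h1
    have h2 := (I ⊔ N * N).sub_mem (Ideal.mem_sup_left (hgI i)) (Ideal.mem_sup_right h1)
    simpa [hJ] using h2
  have hXsq : ∀ i, X i - C (p i) ∈ I ⊔ N * N := fun i => by
    have h1 : ∑ k, C (J⁻¹ i k) * ∑ j, C (J k j) * (X j - C (p j)) ∈ I ⊔ N * N :=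
      Ideal.sum_mem _ fun k _ => Ideal.mul_mem_left _ _ (hlin k)
    convert h1 using 1
    simp_rw [Finset.mul_sum, ← mul_assoc, ← C_mul]
    rw [Finset.sum_comm]
    simp_rw [← Finset.sum_mul, ← map_sum, ← Matrix.mul_apply, Matrix.nonsing_inv_mul J hdet,
      Matrix.one_apply]
    simp
  have hle : N ≤ I ⊔ N * N := fun f hf => by
    have h1 := taylor_mem_sq p N hX f
    rw [(hmem f).1 hf] at h1
    have h2 : ∑ i, C (eval p (pderiv i f)) * (X i - C (p i)) ∈ I ⊔ N * N :=
      Ideal.sum_mem _ fun k _ => Ideal.mul_mem_left _ _ (hXsq k)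
    simpa using Ideal.add_mem _ (Ideal.mem_sup_right h1) h2
  have h3 := Ideal.map_mono (f := Ideal.Quotient.mk I) hle
  rwa [Ideal.map_sup, Ideal.map_mul, Ideal.map_quotient_self, bot_sup_eq,
    Ideal.map_comap_of_surjective _ Ideal.Quotient.mk_surjective] at h3

end Jacobian

/-! ### Independence of the basis of the dual space -/

section Coordinates

variable {E : Type*} [NormedAddCommGroup E] [InnerProductSpace ℝ E]
  (W : Subgroup (E ≃ₗᵢ[ℝ] E)) {n : ℕ}
  (x x' : Module.Basis (Fin n) ℂ (Module.Dual ℂ (ℂ ⊗[ℝ] E)))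

theorem linearForm_apply_basis (i : Fin n) : linearForm x (x i) = MvPolynomial.X i := by
  simp [linearForm]

theorem evalAt_linearForm (v : ℂ ⊗[ℝ] E) (f : Module.Dual ℂ (ℂ ⊗[ℝ] E)) :
    evalAt x v (linearForm x f) = f v := by
  have h : ((MvPolynomial.aeval fun i => x i v :
      MvPolynomial (Fin n) ℂ →ₐ[ℂ] ℂ).toLinearMap ∘ₗ linearForm x) =
      Module.Dual.eval ℂ (ℂ ⊗[ℝ] E) v := by
    refine x.ext fun i => ?_
    simp [linearForm_apply_basis]
  exact LinearMap.congr_fun h f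

theorem linearForm_isHomogeneous (f : Module.Dual ℂ (ℂ ⊗[ℝ] E)) :
    (linearForm x f).IsHomogeneous 1 := by
  rw [linearForm, x.constr_apply_fintype ℂ]
  refine MvPolynomial.IsHomogeneous.sum _ _ _ fun i _ => ?_
  rw [MvPolynomial.smul_eq_C_mul]
  simpa using (MvPolynomial.isHomogeneous_C (Fin n) _).mul (MvPolynomial.isHomogeneous_X ℂ i)

/-- The homomorphism between the coordinate rings for two bases of `V*`. -/
noncomputable def changeHom : MvPolynomial (Fin n) ℂ →ₐ[ℂ] MvPolynomial (Fin n) ℂ :=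
  MvPolynomial.aeval fun i => linearForm x' (x i)

theorem changeHom_linearForm (f : Module.Dual ℂ (ℂ ⊗[ℝ] E)) :
    changeHom x x' (linearForm x f) = linearForm x' f := by
  have h : (changeHom x x').toLinearMap ∘ₗ linearForm x = linearForm x' := by
    refine x.ext fun i => ?_
    simp [linearForm_apply_basis, changeHom]
  exact LinearMap.congr_fun h f

theorem changeHom_comp : (changeHom x' x).comp (changeHom x x') = AlgHom.id ℂ _ := by
  refine MvPolynomial.algHom_ext fun i => ?_
  rw [← linearForm_apply_basis x i]
  simp [changeHom_linearForm]

/-- `changeHom` as an equivalence. -/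
noncomputable def changeEquiv : MvPolynomial (Fin n) ℂ ≃ₐ[ℂ] MvPolynomial (Fin n) ℂ :=
  AlgEquiv.ofAlgHom (changeHom x x') (changeHom x' x) (changeHom_comp x' x) (changeHom_comp x x')

theorem changeEquiv_linearForm (f : Module.Dual ℂ (ℂ ⊗[ℝ] E)) :
    changeEquiv x x' (linearForm x f) = linearForm x' f :=
  changeHom_linearForm x x' f

theorem evalAt_changeEquiv (v : ℂ ⊗[ℝ] E) (p : MvPolynomial (Fin n) ℂ) :
    evalAt x' v (changeEquiv x x' p) = evalAt x v p := by
  have h : (MvPolynomial.aeval fun i => x' i v : MvPolynomial (Fin n) ℂ →ₐ[ℂ] ℂ).comp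
      (changeHom x x') = MvPolynomial.aeval fun i => x i v := by
    refine MvPolynomial.algHom_ext fun i => ?_
    have := evalAt_linearForm x' v (x i)
    simpa [changeHom, evalAt] using this
  exact DFunLike.congr_fun h p

theorem polyAct_linearForm (w : W) (f : Module.Dual ℂ (ℂ ⊗[ℝ] E)) :
    polyAct W x w (linearForm x f) = linearForm x (dualAct W w f) := by
  have h : (polyAct W x w).toLinearMap ∘ₗ linearForm x =
      linearForm x ∘ₗ (complexAct W w⁻¹).dualMap := by
    refine x.ext fun i => ?_
    simp [linearForm_apply_basis, polyAct]
    rfl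
  exact LinearMap.congr_fun h f

theorem polyAct_changeEquiv (w : W) (p : MvPolynomial (Fin n) ℂ) :
    polyAct W x' w (changeEquiv x x' p) = changeEquiv x x' (polyAct W x w p) := by
  have h : (polyAct W x' w).comp (changeHom x x') = (changeHom x x').comp (polyAct W x w) := by
    refine MvPolynomial.algHom_ext fun i => ?_
    rw [← linearForm_apply_basis x i]
    simp [changeHom_linearForm, polyAct_linearForm]
  exact DFunLike.congr_fun h p

/-- The system `Θ` in the coordinates of another basis of `V*`. -/
noncomputable def changeHsop (θ : Fin n → MvPolynomial (Fin n) ℂ) (i : Fin n) :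
    MvPolynomial (Fin n) ℂ :=
  changeEquiv x x' (x.constr ℂ θ (x' i))

theorem constr_changeHsop (θ : Fin n → MvPolynomial (Fin n) ℂ)
    (f : Module.Dual ℂ (ℂ ⊗[ℝ] E)) :
    x'.constr ℂ (changeHsop x x' θ) f = changeEquiv x x' (x.constr ℂ θ f) := by
  have h : x'.constr ℂ (changeHsop x x' θ) =
      (changeEquiv x x').toLinearMap ∘ₗ x.constr ℂ θ := by
    refine x'.ext fun i => ?_
    simp [changeHsop]
  exact LinearMap.congr_fun h f

/-- This makes the ideals `(Θ)` and `(Θ - 𝐱)` intrinsic: each is generated by the image of a linear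
map on `V*`. -/
theorem span_range_basis_eq {M A : Type*} [AddCommGroup M] [Module ℂ M] [CommRing A] [Algebra ℂ A]
    (b : Module.Basis (Fin n) ℂ M) (F : M →ₗ[ℂ] A) :
    Ideal.span (Set.range fun i => F (b i)) = Ideal.span (Set.range F) := by
  refine le_antisymm (Ideal.span_mono (by rintro _ ⟨i, rfl⟩; exact ⟨_, rfl⟩)) ?_
  rw [Ideal.span_le]
  rintro _ ⟨m, rfl⟩
  rw [← b.sum_repr m, map_sum]
  refine Ideal.sum_mem _ fun i _ => ?_
  rw [map_smul, Algebra.smul_def]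
  exact Ideal.mul_mem_left _ _ (Ideal.subset_span ⟨i, rfl⟩)

theorem map_span_range_constr (θ : Fin n → MvPolynomial (Fin n) ℂ) :
    (Ideal.span (Set.range θ)).map (changeEquiv x x' : _ →+* MvPolynomial (Fin n) ℂ) =
      Ideal.span (Set.range (changeHsop x x' θ)) := by
  have h1 := span_range_basis_eq x ((changeEquiv x x').toLinearMap ∘ₗ x.constr ℂ θ)
  have h2 := span_range_basis_eq x' ((changeEquiv x x').toLinearMap ∘ₗ x.constr ℂ θ)
  rw [Ideal.map_span, ← Set.range_comp]
  have e1 : (fun i => ((changeEquiv x x').toLinearMap ∘ₗ x.constr ℂ θ) (x i)) =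
      ((changeEquiv x x' : _ →+* MvPolynomial (Fin n) ℂ) : _ → _) ∘ θ := by
    ext1 i; simp
  have e2 : (fun i => ((changeEquiv x x').toLinearMap ∘ₗ x.constr ℂ θ) (x' i)) =
      changeHsop x x' θ := by
    ext1 i; simp [changeHsop]
  rw [e1] at h1
  rw [e2] at h2
  rw [h1, h2]

theorem map_deformedIdeal (θ : Fin n → MvPolynomial (Fin n) ℂ) :
    (deformedIdeal θ).map (changeEquiv x x' : _ →+* MvPolynomial (Fin n) ℂ) =
      deformedIdeal (changeHsop x x' θ) := by
  have h := map_span_range_constr x x' (fun i => θ i - MvPolynomial.X i)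
  have e : changeHsop x x' (fun i => θ i - MvPolynomial.X i) =
      fun i => changeHsop x x' θ i - MvPolynomial.X i := by
    ext1 i
    have h1 : x.constr ℂ (fun i => θ i - MvPolynomial.X i) = x.constr ℂ θ - linearForm x := by
      refine x.ext fun j => ?_
      simp [linearForm_apply_basis]
    simp only [changeHsop, h1, LinearMap.sub_apply, map_sub, changeEquiv_linearForm,
      linearForm_apply_basis]
  rw [e] at h
  exact h

theorem IsAdmissibleHsop.change {θ : Fin n → MvPolynomial (Fin n) ℂ} {k : ℕ}
    (hθ : IsAdmissibleHsop W x θ k) : IsAdmissibleHsop W x' (changeHsop x x' θ) k where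
  homogeneous i := by
    have h1 : (x.constr ℂ θ (x' i)).IsHomogeneous k := by
      rw [x.constr_apply_fintype ℂ]
      refine MvPolynomial.IsHomogeneous.sum _ _ _ fun j _ => ?_
      rw [MvPolynomial.smul_eq_C_mul]
      simpa using (MvPolynomial.isHomogeneous_C (Fin n) _).mul (hθ.homogeneous j)
    have h2 := h1.aeval (fun i => linearForm x' (x i)) fun i => linearForm_isHomogeneous x' (x i)
    rw [one_mul] at h2
    exact h2
  finite_quotient := by
    have := hθ.finite_quotient
    exact Module.Finite.equiv (Ideal.quotientEquivAlg _ _ (changeEquiv x x')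
      (map_span_range_constr x x' θ).symm).toLinearEquiv
  equivariant w f := by
    rw [constr_changeHsop, constr_changeHsop, hθ.equivariant, polyAct_changeEquiv]

theorem mem_variety_iff {θ : Fin n → MvPolynomial (Fin n) ℂ} {v : ℂ ⊗[ℝ] E} :
    v ∈ variety x θ ↔ ∀ i, evalAt x v (θ i) = x i v := by
  have h : v ∈ variety x θ ↔ deformedIdeal θ ≤ RingHom.ker (MvPolynomial.eval fun i => x i v) :=
    Iff.rfl
  rw [h, deformedIdeal, Ideal.span_le]
  simp [Set.range_subset_iff, sub_eq_zero, evalAt]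

theorem variety_changeHsop (θ : Fin n → MvPolynomial (Fin n) ℂ) :
    variety x' (changeHsop x x' θ) = variety x θ := by
  ext v
  change (∀ p ∈ deformedIdeal (changeHsop x x' θ), _) ↔ ∀ p ∈ deformedIdeal θ, _
  rw [← map_deformedIdeal]
  constructor
  · intro h p hp
    rw [← evalAt_changeEquiv x x']
    exact h _ (Ideal.mem_map_of_mem _ hp)
  · intro h p hp
    obtain ⟨q, hq, rfl⟩ := (Ideal.mem_map_iff_of_surjective _ (changeEquiv x x').surjective).1 hp
    exact (evalAt_changeEquiv x x' v q).trans (h q hq)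

theorem eval_smul_of_isHomogeneous {p : MvPolynomial (Fin n) ℂ} {k : ℕ} (hp : p.IsHomogeneous k)
    (c : ℂ) (z : Fin n → ℂ) :
    MvPolynomial.eval (c • z) p = c ^ k * MvPolynomial.eval z p := by
  rw [MvPolynomial.eval_eq', MvPolynomial.eval_eq', Finset.mul_sum]
  refine Finset.sum_congr rfl fun d hd => ?_
  have h1 : ∑ i, d i = k := by
    rw [← hp (MvPolynomial.mem_support_iff.1 hd), Finsupp.weight_apply, Finsupp.sum_fintype _ _ (by simp)]
    simp
  simp only [Pi.smul_apply, smul_eq_mul, mul_pow, Finset.prod_mul_distrib, Finset.prod_pow_eq_pow_sum,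
    h1]
  ring

theorem isReduced_of_changeHsop (θ : Fin n → MvPolynomial (Fin n) ℂ)
    (h : IsReduced (MvPolynomial (Fin n) ℂ ⧸ deformedIdeal (changeHsop x x' θ))) :
    IsReduced (MvPolynomial (Fin n) ℂ ⧸ deformedIdeal θ) :=
  isReduced_of_injective (Ideal.quotientEquivAlg _ _ (changeEquiv x x')
      (map_deformedIdeal x x' θ).symm) (AlgEquiv.injective _)

/-- A homogeneous system of parameters vanishes only at the origin. -/
theorem IsAdmissibleHsop.eq_zero {θ : Fin n → MvPolynomial (Fin n) ℂ} {k : ℕ}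
    (hθ : IsAdmissibleHsop W x θ k) (z : Fin n → ℂ)
    (hz : ∀ i, MvPolynomial.eval z (θ i) = 0) : z = 0 := by
  by_contra hz0
  obtain ⟨i, hi⟩ : ∃ i, z i ≠ 0 := by
    by_contra! h
    exact hz0 (funext h)
  have := hθ.finite_quotient
  obtain ⟨P, hPm, hP⟩ := Algebra.IsIntegral.isIntegral (R := ℂ)
    (Ideal.Quotient.mk (Ideal.span (Set.range θ)) (MvPolynomial.X i))
  have hmem : Polynomial.aeval (MvPolynomial.X i : MvPolynomial (Fin n) ℂ) P ∈
      Ideal.span (Set.range θ) := by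
    rw [← Ideal.Quotient.eq_zero_iff_mem, ← Ideal.Quotient.mkₐ_eq_mk ℂ, ← Polynomial.aeval_algHom_apply]
    exact hP
  -- By homogeneity all multiples of `z` are zeros of `θ`. The monic `P` that `X i` satisfies modulo
  -- `(θ)` then vanishes at all `c * z i`, hence on all of `ℂ`.
  have hroot : ∀ c : ℂ, P.eval (c * z i) = 0 := by
    intro c
    have hle : Ideal.span (Set.range θ) ≤ RingHom.ker (MvPolynomial.eval (c • z)) := by
      rw [Ideal.span_le]
      rintro _ ⟨j, rfl⟩
      change MvPolynomial.eval (c • z) (θ j) = 0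
      rw [eval_smul_of_isHomogeneous (hθ.homogeneous j), hz, mul_zero]
    have h1 := hle hmem
    change MvPolynomial.aeval (c • z) _ = 0 at h1
    rw [← Polynomial.aeval_algHom_apply] at h1
    simpa using h1
  refine hPm.ne_zero (Polynomial.funext fun r => ?_)
  have := hroot (r / z i)
  rw [div_mul_cancel₀ _ hi] at this
  simpa using this

end Coordinates

/-! ### Equivariant bijections from points attached to flats -/

section Equivariant

variable {E : Type*} [NormedAddCommGroup E] [InnerProductSpace ℝ E]
  (W : Subgroup (E ≃ₗᵢ[ℝ] E))

theorem complexAct_tmul (w : W) (z : ℂ) (y : E) :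
    complexAct W w (z ⊗ₜ y) = z ⊗ₜ (w : E ≃ₗᵢ[ℝ] E) y := rfl

theorem complexAct_one (v : ℂ ⊗[ℝ] E) : complexAct W 1 v = v := by
  induction v with
  | zero => simp
  | tmul z y => rfl
  | add a b ha hb => rw [map_add, ha, hb]

theorem complexAct_mul (u w : W) (v : ℂ ⊗[ℝ] E) :
    complexAct W (u * w) v = complexAct W u (complexAct W w v) := by
  induction v with
  | zero => simp
  | tmul z y => rfl
  | add a b ha hb => rw [map_add, ha, hb, map_add, map_add]

theorem omega_ne_zero (c : W) : omega W c ≠ 0 := Complex.exp_ne_zero _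

theorem image_zpow_equivariant (c : W) {q : Submodule ℝ E → ℂ ⊗[ℝ] E}
    (hq : ∀ X, IsNoncrossing W c X → q (image W c X) = omega W c • complexAct W c (q X))
    {X : Submodule ℝ E} (hX : IsNoncrossing W c X) (d : ℤ) :
    q (image W (c ^ d) X) = omega W c ^ d • complexAct W (c ^ d) (q X) := by
  have hne := omega_ne_zero W c
  have hNC : ∀ d : ℤ, IsNoncrossing W c (image W (c ^ d) X) := fun d =>
    isNoncrossing_image W c ⟨c ^ d, d, rfl⟩ hX
  have hstep : ∀ d : ℤ, q (image W (c ^ (d + 1)) X) =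
      omega W c • complexAct W c (q (image W (c ^ d) X)) := fun d => by
    rw [add_comm, zpow_add, zpow_one, image_mul, hq _ (hNC d)]
  induction d using Int.induction_on with
  | zero => simp [image_one, complexAct_one]
  | succ i ih =>
    rw [hstep, ih, map_smul, smul_smul, ← complexAct_mul, add_comm (i : ℤ) 1, zpow_add, zpow_one,
      zpow_add₀ hne, zpow_one]
  | pred i ih =>
    -- The downward step solves the one-step relation for its right-hand side.
    have h1 := hstep (-(i : ℤ) - 1)
    rw [sub_add_cancel, ih] at h1
    have h2 : (omega W c ^ (-(1 : ℤ))) • complexAct W c⁻¹ (omega W c ^ (-(i : ℤ)) •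
        complexAct W (c ^ (-(i : ℤ))) (q X)) = q (image W (c ^ (-(i : ℤ) - 1)) X) := by
      rw [h1, map_smul, smul_smul, ← complexAct_mul, inv_mul_cancel, complexAct_one, zpow_neg,
        zpow_one, inv_mul_cancel₀ hne, one_smul]
    rw [← h2, map_smul, smul_smul, ← complexAct_mul, ← zpow_add₀ hne, ← zpow_neg_one c, ← zpow_add]
    congr 2 <;> ring_nf

/-- An equivariant choice of points on the noncrossing flats parametrizes a `W × C`-set. -/
theorem exists_equivariant_equiv (c : W) (S : Set (ℂ ⊗[ℝ] E)) (q : Submodule ℝ E → ℂ ⊗[ℝ] E)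
    (hq : ∀ X, IsNoncrossing W c X → q (image W c X) = omega W c • complexAct W c (q X))
    (hfix : ∀ X, IsNoncrossing W c X → ∀ w ∈ pointwiseStabilizer W X, complexAct W w (q X) = q X)
    (hinj : ∀ X X', IsNoncrossing W c X → IsNoncrossing W c X' → ∀ w,
      complexAct W w (q X) = q X' → X = X' ∧ w ∈ pointwiseStabilizer W X)
    (hmem : ∀ X, IsNoncrossing W c X → ∀ w, complexAct W w (q X) ∈ S)
    (hsurj : ∀ v ∈ S, ∃ w X, IsFlat W X ∧ IsNoncrossing W c X ∧ v = complexAct W w (q X)) :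
    ∃ f : parkNC W c ≃ S, ∀ (w : W) (d : ℤ) (p : parkNC W c),
      (f ((w, (⟨c ^ d, d, rfl⟩ : Subgroup.zpowers c)) • p) : ℂ ⊗[ℝ] E) =
        omega W c ^ d • complexAct W w (f p : ℂ ⊗[ℝ] E) := by
  -- Two representatives of a class differ by an element of `W_X`, which fixes `q X`.
  have hwd : ∀ p : parkNC W c, ∃ v : S, ∀ (w : W) (X : Flat W), p.1 = ParkAll.mk W w X →
      (v : ℂ ⊗[ℝ] E) = complexAct W w (q X.1) := by
    rintro ⟨_, w, X, hX, rfl⟩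
    refine ⟨⟨complexAct W w (q X.1), hmem _ hX w⟩, fun w' X' h => ?_⟩
    obtain ⟨h1, h2⟩ : X = X' ∧ (QuotientGroup.mk w : W ⧸ pointwiseStabilizer W X.1) =
      QuotientGroup.mk w' := Quotient.exact h
    obtain rfl := h1
    have h3 := hfix _ hX _ (QuotientGroup.eq.1 h2)
    change complexAct W w (q X.1) = _
    rw [← h3, ← complexAct_mul, mul_inv_cancel_left, h3]
  choose F hF using hwd
  have hbij : Function.Bijective F := by
    constructor
    · rintro ⟨_, w, X, hX, rfl⟩ ⟨_, w', X', hX', rfl⟩ h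
      have h1 := hF ⟨_, w, X, hX, rfl⟩ w X rfl
      have h2 := hF ⟨_, w', X', hX', rfl⟩ w' X' rfl
      rw [h, h2] at h1
      have h3 : complexAct W (w⁻¹ * w') (q X'.1) = q X.1 := by
        rw [complexAct_mul, h1, ← complexAct_mul, inv_mul_cancel, complexAct_one]
      obtain ⟨h4, h5⟩ := hinj _ _ hX' hX _ h3
      obtain rfl : X = X' := Subtype.ext h4.symm
      exact Subtype.ext (Quotient.sound (s := parkSetoid W) ⟨rfl, QuotientGroup.eq.2 h5⟩)
    · rintro ⟨v, hv⟩
      obtain ⟨w, X, hXf, hX, rfl⟩ := hsurj v hv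
      exact ⟨⟨ParkAll.mk W w ⟨X, hXf⟩, w, ⟨X, hXf⟩, hX, rfl⟩,
        Subtype.ext (hF ⟨_, w, ⟨X, hXf⟩, hX, rfl⟩ w ⟨X, hXf⟩ rfl)⟩
  refine ⟨Equiv.ofBijective F hbij, ?_⟩
  rintro w d ⟨_, u, X, hX, rfl⟩
  -- The factor `(c ^ d)⁻¹` in the action cancels the `c ^ d` produced by `q`, leaving only the
  -- scalar `ω ^ d`.
  rw [Equiv.ofBijective_apply, Equiv.ofBijective_apply, hF ⟨_, u, X, hX, rfl⟩ u X rfl,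
    hF _ (w * u * (c ^ d)⁻¹) ⟨image W (c ^ d) X.1, isFlat_image W _ X.2⟩ rfl,
    image_zpow_equivariant W c hq hX, map_smul, ← complexAct_mul, ← complexAct_mul,
    inv_mul_cancel_right]

end Equivariant

/-! ### Reflection length of short products -/

section ReflectionLength

variable {E : Type*} [NormedAddCommGroup E] [InnerProductSpace ℝ E]
  (W : Subgroup (E ≃ₗᵢ[ℝ] E))

theorem reflectionLength_le {w : W} (l : List W) (hl : ∀ t ∈ l, IsReflection W t)
    (hw : l.prod = w) : reflectionLength W w ≤ l.length :=
  Nat.sInf_le ⟨l, rfl, hl, hw⟩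

theorem reflectionLength_one : reflectionLength W 1 = 0 :=
  Nat.le_zero.1 (reflectionLength_le W [] (by simp) rfl)

/-- The infimum of an empty set of naturals is `0`, so some factorization must be supplied before
the minimum is known to be attained. -/
theorem exists_list_reflectionLength {w : W} {l : List W} (hl : ∀ t ∈ l, IsReflection W t)
    (hw : l.prod = w) : ∃ l : List W, l.length = reflectionLength W w ∧
      (∀ t ∈ l, IsReflection W t) ∧ l.prod = w :=
  Nat.sInf_mem (s := {k | ∃ l : List W, l.length = k ∧ (∀ t ∈ l, IsReflection W t) ∧ l.prod = w})
    ⟨_, l, rfl, hl, hw⟩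

theorem isNoncrossing_top (c : W) : IsNoncrossing W c ⊤ :=
  ⟨1, by simp [AbsLE, reflectionLength_one], by ext; simp [fixedSpace]⟩

theorem isNoncrossing_fixedSpace_self (c : W) : IsNoncrossing W c (fixedSpace W c) :=
  ⟨c, by simp [AbsLE, reflectionLength_one], rfl⟩

theorem isFlat_top : IsFlat W ⊤ := ⟨∅, by simp, by simp⟩

theorem IsReflection.mul_self {t : W} (ht : IsReflection W t) : t * t = 1 := by
  obtain ⟨α, -, h⟩ := ht
  refine Subtype.ext ?_
  rw [Subgroup.coe_mul, h]
  exact Submodule.reflection_mul_reflection _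

theorem IsReflection.ne_one {t : W} (ht : IsReflection W t) : t ≠ 1 := by
  obtain ⟨α, hα, h⟩ := ht
  rintro rfl
  have h1 : refl α α = α := by rw [← h]; rfl
  have h2 : refl α α = -α :=
    Submodule.reflection_mem_subspace_orthogonal_precomplement_eq_neg
      (Submodule.mem_span_singleton_self α)
  have h3 : α = 0 := by
    rw [h1] at h2
    have h4 : (2 : ℝ) • α = 0 := by rw [two_smul]; nth_rewrite 1 [h2]; simp
    simpa using h4
  have := hα.1
  simp [h3] at this

theorem IsReflection.reflectionLength {t : W} (ht : IsReflection W t) :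
    reflectionLength W t = 1 := by
  refine le_antisymm (reflectionLength_le W [t] (by simpa using ht) (by simp)) ?_
  obtain ⟨l, h1, -, h3⟩ := exists_list_reflectionLength W (l := [t]) (w := t)
    (by simpa using ht) (by simp)
  rw [← h1, Nat.one_le_iff_ne_zero]
  intro h
  rw [List.length_eq_zero_iff.1 h] at h3
  exact ht.ne_one W h3.symm

/-- A product of at most one reflection squares to `1`. -/
theorem reflectionLength_mul {s t : W} (hs : IsReflection W s) (ht : IsReflection W t)
    (h : (s * t) * (s * t) ≠ 1) : reflectionLength W (s * t) = 2 := by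
  have hl : ∀ r ∈ [s, t], IsReflection W r := by simp [hs, ht]
  refine le_antisymm (reflectionLength_le W [s, t] hl (by simp)) ?_
  obtain ⟨l, h1, h2, h3⟩ := exists_list_reflectionLength W hl (w := s * t) (by simp)
  rw [← h1]
  match l with
  | [] => simp [← h3] at h
  | [r] =>
    refine (h ?_).elim
    rw [← h3, List.prod_singleton]
    exact (h2 r (by simp)).mul_self W
  | _ :: _ :: _ => simp

end ReflectionLength

/-! ### Chambers as cones cut out by roots -/

section Chambers

variable {E : Type*} [NormedAddCommGroup E] [InnerProductSpace ℝ E]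
  {W : Subgroup (E ≃ₗᵢ[ℝ] E)}

theorem mem_hyperplane {α y : E} : y ∈ hyperplane α ↔ inner ℝ α y = 0 := by
  rw [hyperplane, Submodule.mem_orthogonal_singleton_iff_inner_right]

theorem refl_eq (α y : E) (hα : ‖α‖ = 1) : refl α y = y - (2 * inner ℝ α y) • α := by
  rw [refl, Submodule.reflection_orthogonal_apply, Submodule.reflection_singleton_apply]
  simp [hα, mul_smul, two_smul]

theorem refl_neg (α : E) : refl (-α) = refl α := by
  have h : (ℝ ∙ -α) = ℝ ∙ α := by
    rw [← Set.neg_singleton, Submodule.span_neg]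
  simp only [refl, h]

theorem neg_mem_roots {α : E} (hα : α ∈ roots W) : -α ∈ roots W :=
  ⟨by simpa using hα.1, by rw [refl_neg]; exact hα.2⟩

theorem mem_regularSet {x : E} : x ∈ regularSet W ↔ ∀ α ∈ roots W, inner ℝ α x ≠ 0 := by
  simp [regularSet, mem_hyperplane]

/-- No root changes sign on a connected subset of the regular set, by the intermediate value
theorem; conversely the sign conditions define a convex set. Roots negative at `x` are covered by
their opposites. -/
theorem chamber_eq {x : E} (hx : x ∈ regularSet W) :
    connectedComponentIn (regularSet W) x =
      {y | ∀ α ∈ roots W, 0 < inner ℝ α x → 0 < inner ℝ α y} := by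
  apply Set.Subset.antisymm
  · intro y hy α hα hαx
    by_contra! hle
    have hpre := isPreconnected_connectedComponentIn (x := x) (F := regularSet W)
    obtain ⟨z, hz, hz0⟩ := hpre.intermediate_value hy (mem_connectedComponentIn hx)
      (f := fun y => inner ℝ α y) (by fun_prop) ⟨hle, hαx.le⟩
    exact mem_regularSet.1 (connectedComponentIn_subset _ _ hz) α hα hz0
  · refine IsPreconnected.subset_connectedComponentIn ?_ (fun α _ h => h) ?_
    · refine Convex.isPreconnected fun y hy z hz a b ha hb hab α hα hαx => ?_
      have h1 := hy α hα hαx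
      have h2 := hz α hα hαx
      rw [inner_add_right, inner_smul_right, inner_smul_right]
      rcases ha.eq_or_lt with rfl | ha
      · obtain rfl : b = 1 := by linarith
        simpa using h2
      · have := mul_pos ha h1
        have := mul_nonneg hb h2.le
        linarith
    · intro y hy
      rw [mem_regularSet] at hx ⊢
      intro α hα
      rcases lt_or_gt_of_ne (hx α hα) with h | h
      · have := hy (-α) (neg_mem_roots hα) (by simpa using h)
        rw [inner_neg_left] at this
        linarith
      · exact (hy α hα h).ne'

/-- Replacing `y` by `y + ε • x` makes all the weak inequalities strict. -/
theorem closure_chamber_eq {x : E} (hx : x ∈ regularSet W) :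
    closure (connectedComponentIn (regularSet W) x) =
      {y | ∀ α ∈ roots W, 0 < inner ℝ α x → 0 ≤ inner ℝ α y} := by
  rw [chamber_eq hx]
  apply Set.Subset.antisymm
  · refine closure_minimal (fun y hy α hα h => (hy α hα h).le) ?_
    simp only [Set.ofPred_forall]
    refine isClosed_iInter fun α => isClosed_iInter fun _ => isClosed_iInter fun _ =>
      isClosed_le continuous_const (by fun_prop)
  · intro y hy
    have hlim : Filter.Tendsto (fun ε : ℝ => y + ε • x) (nhdsWithin 0 (Set.Ioi 0)) (nhds y) := by
      have : Continuous fun ε : ℝ => y + ε • x := by fun_prop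
      have h := this.tendsto 0
      simp only [zero_smul, add_zero] at h
      exact h.mono_left nhdsWithin_le_nhds
    refine mem_closure_of_tendsto hlim ?_
    filter_upwards [self_mem_nhdsWithin] with ε hε α hα hαx
    rw [inner_add_right, inner_smul_right]
    have := hy α hα hαx
    have : 0 < ε * inner ℝ α x := mul_pos hε hαx
    linarith

theorem mem_positiveRoots {x : E} (hx : x ∈ regularSet W) {α : E} :
    α ∈ positiveRoots W (connectedComponentIn (regularSet W) x) ↔
      α ∈ roots W ∧ 0 < inner ℝ α x := by
  refine ⟨fun h => ⟨h.1, h.2 x (mem_connectedComponentIn hx)⟩, fun h => ⟨h.1, fun y hy => ?_⟩⟩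
  rw [chamber_eq hx] at hy
  exact hy α h.1 h.2

theorem IsIrreducibleReflectionGroup.exists_root (hW : IsIrreducibleReflectionGroup W) :
    ∃ α, α ∈ roots W := by
  by_contra! h
  have h1 := hW.generated
  rw [Set.eq_empty_iff_forall_notMem.2 h, Set.image_empty, Subgroup.closure_empty] at h1
  have := hW.nontrivial
  rw [← h1] at this
  exact not_subsingleton _ (inferInstance : Subsingleton (⊥ : Subgroup (E ≃ₗᵢ[ℝ] E)))

end Chambers

/-! ### Coordinates on the complexification -/

section Coords

variable {E : Type*} [NormedAddCommGroup E] [InnerProductSpace ℝ E] [FiniteDimensional ℝ E] {n : ℕ}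
  (x : Module.Basis (Fin n) ℂ (Module.Dual ℂ (ℂ ⊗[ℝ] E)))

/-- The coordinates on `V` given by a basis of `V*`. -/
noncomputable def coords : (ℂ ⊗[ℝ] E) ≃ₗ[ℂ] (Fin n → ℂ) :=
  LinearEquiv.ofInjectiveOfFinrankEq (LinearMap.pi x)
    (by
      rw [← LinearMap.ker_eq_bot, LinearMap.ker_eq_bot']
      intro v hv
      rw [← Module.forall_dual_apply_eq_zero_iff ℂ]
      intro f
      rw [← x.sum_repr f]
      have h : ∀ i, x i v = 0 := fun i => congrFun hv i
      rw [LinearMap.sum_apply]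
      simp only [LinearMap.smul_apply, h, smul_zero, Finset.sum_const_zero])
    (by
      rw [← Subspace.dual_finrank_eq, Module.finrank_eq_card_basis x]
      simp)

theorem coords_apply (v : ℂ ⊗[ℝ] E) (i : Fin n) : coords x v i = x i v := rfl

theorem coords_symm_apply (z : Fin n → ℂ) (i : Fin n) : x i ((coords x).symm z) = z i := by
  rw [← coords_apply, LinearEquiv.apply_symm_apply]

theorem basis_ext {v v' : ℂ ⊗[ℝ] E} (h : ∀ i, x i v = x i v') : v = v' :=
  (coords x).injective (funext h)

theorem eval_zero_of_isHomogeneous {p : MvPolynomial (Fin n) ℂ} {k : ℕ}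
    (hp : p.IsHomogeneous k) (hk : k ≠ 0) : MvPolynomial.eval 0 p = 0 := by
  have := eval_smul_of_isHomogeneous hp 0 0
  simpa [hk] using this

end Coords

/-! ### Rank one -/

section RankOne

variable {E : Type*} [NormedAddCommGroup E] [InnerProductSpace ℝ E]
  {W : Subgroup (E ≃ₗᵢ[ℝ] E)}

theorem exists_smul_of_finrank_one (hE : Module.finrank ℝ E = 1) {α : E} (hα : ‖α‖ = 1) (y : E) :
    ∃ r : ℝ, y = r • α := by
  have h0 : α ≠ 0 := by rintro rfl; simp at hα
  obtain ⟨r, hr⟩ := (finrank_eq_one_iff_of_nonzero' α h0).1 hE y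
  exact ⟨r, hr.symm⟩

theorem refl_eq_neg_of_finrank_one (hE : Module.finrank ℝ E = 1) {α : E} (hα : ‖α‖ = 1) (y : E) :
    refl α y = -y := by
  obtain ⟨r, rfl⟩ := exists_smul_of_finrank_one hE hα y
  rw [refl_eq _ _ hα, inner_smul_right, real_inner_self_eq_norm_sq, hα, ← sub_smul, ← neg_smul]
  ring_nf

/-- On a line every root hyperplane is zero, so the wall condition is automatic and a chamber has
exactly one simple root. -/
theorem coxeter_eq_neg_of_finrank_one (hE : Module.finrank ℝ E = 1)
    (hW : IsIrreducibleReflectionGroup W) {c : W} (hc : IsCoxeterElement W c) (y : E) :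
    (c : E ≃ₗᵢ[ℝ] E) y = -y := by
  obtain ⟨D, ⟨x, hx, rfl⟩, l, hl, hmem, hprod⟩ := hc
  obtain ⟨α, hα, hαx⟩ : ∃ α ∈ roots W, 0 < inner ℝ α x := by
    obtain ⟨α, hα⟩ := hW.exists_root
    rcases lt_or_gt_of_ne (mem_regularSet.1 hx α hα) with h | h
    · exact ⟨-α, neg_mem_roots hα, by simpa using h⟩
    · exact ⟨α, hα, h⟩
  have hbot : hyperplane α = ⊥ := by
    rw [Submodule.eq_bot_iff]
    intro y hy
    obtain ⟨r, rfl⟩ := exists_smul_of_finrank_one hE hα.1 y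
    rw [mem_hyperplane, inner_smul_right, real_inner_self_eq_norm_sq, hα.1] at hy
    simp at hy
    simp [hy]
  have hsimple : ∀ β, β ∈ l ↔ β = α := by
    intro β
    rw [hmem]
    constructor
    · rintro ⟨hβ, -⟩
      obtain ⟨hβ, hβx⟩ := (mem_positiveRoots hx).1 hβ
      obtain ⟨r, rfl⟩ := exists_smul_of_finrank_one hE hα.1 β
      have h1 := hβ.1
      rw [norm_smul, hα.1, mul_one, Real.norm_eq_abs] at h1
      rw [real_inner_smul_left] at hβx
      have : 0 < r := pos_of_mul_pos_left hβx hαx.le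
      rw [abs_of_pos this] at h1
      rw [h1, one_smul]
    · rintro rfl
      refine ⟨(mem_positiveRoots hx).2 ⟨hα, hαx⟩, ?_⟩
      rw [hbot, Submodule.span_eq_bot]
      rintro y ⟨hy, -⟩
      simpa using hy
  have hl1 : l = [α] := by
    rw [← List.perm_singleton, List.perm_ext_iff_of_nodup hl (List.nodup_singleton α)]
    simpa using hsimple
  rw [hprod, hl1]
  simpa using refl_eq_neg_of_finrank_one hE hα.1 y

theorem eq_one_or_eq_of_finrank_one (hE : Module.finrank ℝ E = 1) {c : W}
    (hc : ∀ y, (c : E ≃ₗᵢ[ℝ] E) y = -y) (w : W) : w = 1 ∨ w = c := by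
  obtain ⟨α, hα⟩ : ∃ α : E, ‖α‖ = 1 := by
    have : Nontrivial E := Module.nontrivial_of_finrank_pos (R := ℝ) (by omega)
    exact exists_norm_eq E zero_le_one
  obtain ⟨r, hr⟩ := exists_smul_of_finrank_one hE hα ((w : E ≃ₗᵢ[ℝ] E) α)
  have hw : ∀ y, (w : E ≃ₗᵢ[ℝ] E) y = r • y := by
    intro y
    obtain ⟨s, rfl⟩ := exists_smul_of_finrank_one hE hα y
    rw [map_smul, hr, smul_comm]
  have h1 : |r| = 1 := by
    have h2 := (w : E ≃ₗᵢ[ℝ] E).norm_map α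
    rwa [hw, norm_smul, hα, mul_one] at h2
  rcases eq_or_eq_neg_of_abs_eq h1 with h | h
  · left
    ext y
    simp [hw, h]
  · right
    ext y
    simp [hw, h, hc]

theorem mainTheorem_rank_one [FiniteDimensional ℝ E] (hE : Module.finrank ℝ E = 1)
    (hW : IsIrreducibleReflectionGroup W) (c : W) (hc : IsCoxeterElement W c)
    (x : Module.Basis (Fin 1) ℂ (Module.Dual ℂ (ℂ ⊗[ℝ] E)))
    (θ : Fin 1 → MvPolynomial (Fin 1) ℂ) (hθ : IsAdmissibleHsop W x θ (orderOf c + 1)) :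
    (variety x θ).encard = (((orderOf c + 1) ^ 1 : ℕ) : ℕ∞) ∧
    IsReduced (MvPolynomial (Fin 1) ℂ ⧸ deformedIdeal θ) ∧
    ∃ f : parkNC W c ≃ variety x θ,
      ∀ (w : W) (d : ℤ) (p : parkNC W c),
        (f ((w, (⟨c ^ d, d, rfl⟩ : Subgroup.zpowers c)) • p) : ℂ ⊗[ℝ] E) =
          omega W c ^ d • complexAct W w (f p : ℂ ⊗[ℝ] E) := by
  have hneg := coxeter_eq_neg_of_finrank_one hE hW hc
  have hW2 := eq_one_or_eq_of_finrank_one hE hneg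
  have hnt : Nontrivial E := hW.space_nontrivial
  obtain ⟨e, he⟩ := exists_ne (0 : E)
  have hsmul2 : ∀ y : E, y = -y → y = 0 := by
    intro y hy
    have h4 : (2 : ℝ) • y = 0 := by rw [two_smul]; nth_rewrite 1 [hy]; simp
    simpa using h4
  have hc1 : c ≠ 1 := by
    rintro rfl
    exact he (hsmul2 e (hneg e))
  have hord : orderOf c = 2 := by
    refine orderOf_eq_prime ?_ hc1
    ext y
    simp [pow_two, hneg]
  have homega : omega W c = -1 := by
    rw [omega, hord, ← Complex.exp_pi_mul_I]
    congr 1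
    push_cast
    ring
  have hcV : ∀ v, complexAct W c v = -v := by
    intro v
    induction v with
    | zero => simp
    | tmul z y => rw [complexAct_tmul, hneg, TensorProduct.tmul_neg]
    | add a b ha hb => rw [map_add, ha, hb, neg_add]
  have hom := hθ.homogeneous 0
  rw [hord] at hom
  set a := MvPolynomial.eval (fun _ => 1) (θ 0) with ha
  have heval : ∀ z : Fin 1 → ℂ, MvPolynomial.eval z (θ 0) = a * z 0 ^ 3 := by
    intro z
    have h1 := eval_smul_of_isHomogeneous hom (z 0) (fun _ => 1)
    have h2 : z = z 0 • (fun _ => 1) := by ext i; fin_cases i; simp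
    rw [h2, h1]
    rw [← ha]
    simp [mul_comm]
  have ha0 : a ≠ 0 := by
    intro h
    have := hθ.eq_zero W x (fun _ => 1) (by intro i; fin_cases i; exact h)
    simpa using congrFun this 0
  -- The nonzero solutions of `a z³ = z` are then `b` and `-b`.
  obtain ⟨b, hb⟩ : ∃ b : ℂ, a * b ^ 2 = 1 := by
    obtain ⟨b, hb⟩ := IsAlgClosed.exists_pow_nat_eq a⁻¹ (n := 2) (by norm_num)
    exact ⟨b, by rw [hb, mul_inv_cancel₀ ha0]⟩
  have hb0 : b ≠ 0 := by rintro rfl; simp at hb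
  set p : ℂ ⊗[ℝ] E := (coords x).symm (fun _ => b) with hp
  have hxp : x 0 p = b := coords_symm_apply x _ 0
  have hp0 : p ≠ 0 := by
    intro h
    rw [h, map_zero] at hxp
    exact hb0 hxp.symm
  have hpn : p ≠ -p := by
    intro h
    have h1 := congrArg (x 0) h
    rw [map_neg, hxp] at h1
    exact hb0 (self_eq_neg.1 h1)
  have hmem : ∀ v, v ∈ variety x θ ↔ v = 0 ∨ v = p ∨ v = -p := by
    intro v
    rw [mem_variety_iff]
    have h1 : (∀ i, evalAt x v (θ i) = x i v) ↔ a * x 0 v ^ 3 = x 0 v := by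
      rw [Fin.forall_fin_one, evalAt, heval]
    rw [h1]
    constructor
    · intro h
      have h2 : x 0 v * ((x 0 v - b) * (x 0 v + b)) = 0 := by
        refine (mul_eq_zero.1 (?_ : a * _ = 0)).resolve_left ha0
        linear_combination h - x 0 v * hb
      rcases mul_eq_zero.1 h2 with h | h
      · exact Or.inl (basis_ext x fun i => by fin_cases i; simpa using h)
      · rcases mul_eq_zero.1 h with h | h
        · refine Or.inr (Or.inl (basis_ext x fun i => ?_))
          fin_cases i
          simpa [hxp] using sub_eq_zero.1 h
        · refine Or.inr (Or.inr (basis_ext x fun i => ?_))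
          fin_cases i
          simpa [hxp] using eq_neg_of_add_eq_zero_left h
    · rintro (rfl | rfl | rfl)
      · simp
      · rw [hxp]
        linear_combination b * hb
      · rw [map_neg, hxp]
        linear_combination -b * hb
  have hset : variety x θ = {0, p, -p} := by
    ext v
    rw [hmem]
    simp
  have hNC : ∀ X, IsNoncrossing W c X → X = ⊤ ∨ X = ⊥ := by
    rintro X ⟨u, -, rfl⟩
    rcases hW2 u with rfl | rfl
    · left
      ext y
      simp [fixedSpace]
    · right
      rw [Submodule.eq_bot_iff]
      intro y hy
      exact hsmul2 y ((show (u : E ≃ₗᵢ[ℝ] E) y = y from hy).symm.trans (hneg y))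
  have hfixc : fixedSpace W c = ⊥ := by
    rw [Submodule.eq_bot_iff]
    intro y hy
    exact hsmul2 y ((show (c : E ≃ₗᵢ[ℝ] E) y = y from hy).symm.trans (hneg y))
  have htb : (⊤ : Submodule ℝ E) ≠ ⊥ := top_ne_bot
  refine ⟨?_, ?_, ?_⟩
  · rw [hset, hord, Set.encard_insert_of_notMem, Set.encard_pair hpn]
    · norm_num
    · simp [hp0, hp0.symm]
  · refine isReduced_of_jacobian _ fun z hz => ?_
    rw [Matrix.det_fin_one]
    simp only [Matrix.of_apply, map_sub, MvPolynomial.pderiv_X_self, map_one]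
    -- Euler's identity reads `z θ'(z) = 3 θ(z) = 3 z` at a solution, so the Jacobian is `2` away
    -- from the origin; at the origin it is `-1`.
    have h1 := congrArg (MvPolynomial.eval z) hom.sum_X_mul_pderiv
    simp only [Finset.univ_unique, Finset.sum_singleton, Fin.default_eq_zero, map_mul,
      MvPolynomial.eval_X, map_nsmul] at h1
    have h2 := hz 0
    simp only [map_sub, MvPolynomial.eval_X, sub_eq_zero] at h2
    rw [h2] at h1
    by_cases hz0 : z 0 = 0
    · have h3 : z = 0 := by ext i; fin_cases i; simpa using hz0
      rw [h3, eval_zero_of_isHomogeneous hom.pderiv (by norm_num)]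
      norm_num
    · have h3 : MvPolynomial.eval z (MvPolynomial.pderiv 0 (θ 0)) = 3 := by
        apply mul_left_cancel₀ hz0
        rw [h1]
        simp [mul_comm]
      rw [h3]
      norm_num
  · classical
    -- Both `c` and `ω` act as `-1`, so `ω c` is the identity and any choice of `p` over `-p` works.
    refine exists_equivariant_equiv W c _ (fun X => if X = ⊥ then 0 else p) ?_ ?_ ?_ ?_ ?_
    · intro X hX
      have himg : image W c X = X := by
        ext y
        rw [mem_image]
        have : (c : E ≃ₗᵢ[ℝ] E).symm y = -y := by
          rw [LinearIsometryEquiv.symm_apply_eq, hneg, neg_neg]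
        rw [this, neg_mem_iff]
      simp only [himg, hcV, homega, neg_smul, one_smul, neg_neg]
    · intro X hX w hw
      rcases hNC X hX with rfl | rfl
      · obtain rfl : w = 1 := by
          ext y
          exact hw y trivial
        simp [complexAct_one]
      · simp
    · intro X X' hX hX' w h
      have hinj : complexAct W w p ≠ 0 := by
        rcases hW2 w with rfl | rfl
        · rwa [complexAct_one]
        · rwa [hcV, neg_ne_zero]
      rcases hNC X hX with rfl | rfl <;> rcases hNC X' hX' with rfl | rfl
      · refine ⟨rfl, ?_⟩
        rcases hW2 w with rfl | rfl
        · exact one_mem _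
        · simp only [htb, if_false, hcV] at h
          exact (hpn h.symm).elim
      · simp [htb, hinj] at h
      · simp [htb, hp0.symm] at h
      · refine ⟨rfl, fun y hy => ?_⟩
        rw [(Submodule.mem_bot ℝ).1 hy, map_zero]
    · intro X hX w
      rw [hmem]
      split_ifs
      · simp
      · rcases hW2 w with rfl | rfl
        · simp [complexAct_one]
        · simp [hcV]
    · intro v hv
      rcases (hmem v).1 hv with rfl | rfl | rfl
      · refine ⟨1, ⊥, ?_, ?_, by simp⟩
        · obtain ⟨α, hα⟩ := hW.exists_root
          refine ⟨{α}, by simpa using hα, ?_⟩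
          rw [iInf_singleton, eq_comm, Submodule.eq_bot_iff]
          intro y hy
          have h1 := refl_eq α y hα.1
          rw [mem_hyperplane.1 hy, refl_eq_neg_of_finrank_one hE hα.1] at h1
          refine hsmul2 y ?_
          rw [h1]
          simp
        · rw [← hfixc]
          exact isNoncrossing_fixedSpace_self W c
      · exact ⟨1, ⊤, isFlat_top W, isNoncrossing_top W c, by simp [htb, complexAct_one]⟩
      · exact ⟨c, ⊤, isFlat_top W, isNoncrossing_top W c, by simp [htb, hcV]⟩

end RankOne

/-! ### Isometries of the plane in a complex coordinate -/

section Planar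

open Complex ComplexConjugate

variable {E : Type*} [NormedAddCommGroup E] [InnerProductSpace ℝ E]
  {W : Subgroup (E ≃ₗᵢ[ℝ] E)} (e : E ≃ₗᵢ[ℝ] ℂ)

theorem isometry_mul_apply (g k : E ≃ₗᵢ[ℝ] E) (y : E) : (g * k) y = g (k y) := rfl

theorem isometry_apply_inv (g : E ≃ₗᵢ[ℝ] E) (y : E) : g (g⁻¹ y) = y :=
  g.apply_symm_apply y

theorem isometry_eq_rotation_or_reflection (g : E ≃ₗᵢ[ℝ] E) :
    ∃ a : ℂ, ‖a‖ = 1 ∧ ((∀ y, e (g y) = a * e y) ∨ ∀ y, e (g y) = a * conj (e y)) := by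
  obtain ⟨a, ha⟩ := linear_isometry_complex ((e.symm.trans g).trans e)
  refine ⟨a, a.norm_coe, ?_⟩
  rcases ha with ha | ha
  · left
    intro y
    have := DFunLike.congr_fun ha (e y)
    simpa using this
  · right
    intro y
    have := DFunLike.congr_fun ha (e y)
    simpa using this

theorem inner_eq_re (α y : E) : inner ℝ α y = (conj (e α) * e y).re := by
  rw [← e.inner_map_map, Complex.inner, mul_comm]

theorem conj_mul_self_of_norm_one {a : ℂ} (ha : ‖a‖ = 1) : conj a * a = 1 := by
  rw [← Complex.normSq_eq_conj_mul_self, Complex.normSq_eq_norm_sq, ha]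
  simp

theorem e_refl_apply {α : E} (hα : ‖α‖ = 1) (y : E) :
    e (refl α y) = -(e α) ^ 2 * conj (e y) := by
  have h1 : conj (e α) * e α = 1 := conj_mul_self_of_norm_one (by simpa using hα)
  rw [refl_eq _ _ hα, map_sub, map_smul, inner_eq_re e, Complex.real_smul]
  have h2 : ((2 * (conj (e α) * e y).re : ℝ) : ℂ) = conj (e α) * e y + e α * conj (e y) := by
    have := Complex.add_conj (conj (e α) * e y)
    rw [map_mul, Complex.conj_conj] at this
    exact this.symm
  rw [h2]
  linear_combination (-e y) * h1

theorem eq_refl_of_apply {α : E} (hα : ‖α‖ = 1) {g : E ≃ₗᵢ[ℝ] E}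
    (hg : ∀ y, e (g y) = -(e α) ^ 2 * conj (e y)) : g = refl α := by
  ext y
  apply e.injective
  rw [hg, e_refl_apply e hα]

/-- The rotations in `W`, as complex numbers. -/
def rotationSubgroup (W : Subgroup (E ≃ₗᵢ[ℝ] E)) : Subgroup ℂˣ where
  carrier := {a | ∃ g ∈ W, ∀ y, e (g y) = a * e y}
  mul_mem' := by
    rintro a b ⟨g, hg, hga⟩ ⟨k, hk, hkb⟩
    refine ⟨g * k, W.mul_mem hg hk, fun y => ?_⟩
    rw [isometry_mul_apply, hga, hkb, Units.val_mul, mul_assoc]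
  one_mem' := ⟨1, W.one_mem, by simp⟩
  inv_mem' := by
    rintro a ⟨g, hg, hga⟩
    refine ⟨g⁻¹, W.inv_mem hg, fun y => ?_⟩
    have h1 := hga (g⁻¹ y)
    rw [isometry_apply_inv] at h1
    rw [h1, Units.inv_mul_cancel_left]

/-- The rotations form a finite subgroup of `ℂˣ`. If its order is `m`, it lies in the group of
`m`-th roots of unity, which also has `m` elements. -/
theorem exists_rotation_order (hW : Finite W) :
    ∃ m : ℕ, 0 < m ∧ ∀ a : ℂ, (∃ g ∈ W, ∀ y, e (g y) = a * e y) ↔ a ^ m = 1 := by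
  set R := rotationSubgroup e W with hR
  have hfin : Finite R := by
    have h : ∀ a : R, ∃ g : W, ∀ y, e ((g : E ≃ₗᵢ[ℝ] E) y) = (a.1 : ℂ) * e y := by
      rintro ⟨a, g, hg, hga⟩
      exact ⟨⟨g, hg⟩, hga⟩
    choose F hF using h
    refine Finite.of_injective F fun a b hab => ?_
    have h1 := hF a (e.symm 1)
    rw [hab, hF b] at h1
    simp only [LinearIsometryEquiv.apply_symm_apply, mul_one] at h1
    exact Subtype.ext (Units.ext h1.symm)
  have hm : 0 < Nat.card R := Nat.card_pos
  have : NeZero (Nat.card R) := ⟨hm.ne'⟩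
  have hle : R ≤ rootsOfUnity (Nat.card R) ℂ := by
    intro a ha
    rw [_root_.mem_rootsOfUnity]
    have h1 : (⟨a, ha⟩ : R) ^ Nat.card R = 1 := pow_card_eq_one'
    exact congrArg Subtype.val h1
  have heq : R = rootsOfUnity (Nat.card R) ℂ := by
    refine Subgroup.eq_of_le_of_card_ge hle ?_
    exact (Complex.card_rootsOfUnity _).le
  refine ⟨Nat.card R, hm, fun a => ⟨?_, fun h => ?_⟩⟩
  · rintro ⟨g, hg, hga⟩
    have ha : a ≠ 0 := by
      rintro rfl
      have h1 := hga (g⁻¹ (e.symm 1))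
      rw [isometry_apply_inv] at h1
      simp at h1
    have h1 := hle (show Units.mk0 a ha ∈ R from ⟨g, hg, hga⟩)
    rw [_root_.mem_rootsOfUnity] at h1
    simpa using congrArg Units.val h1
  · have ha : a ≠ 0 := by
      rintro rfl
      simp [hm.ne'] at h
    have h1 : Units.mk0 a ha ∈ rootsOfUnity (Nat.card R) ℂ := by
      rw [_root_.mem_rootsOfUnity]
      ext
      simpa using h
    rw [← heq] at h1
    exact h1

/-- A group of isometries of the plane in which every rotation is `±1` is not irreducible. -/
theorem three_le_of_irreducible (hE : Module.finrank ℝ E = 2)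
    (hW : IsIrreducibleReflectionGroup W) {m : ℕ} (hm0 : 0 < m)
    (hm : ∀ a : ℂ, (∃ g ∈ W, ∀ y, e (g y) = a * e y) ↔ a ^ m = 1) : 3 ≤ m := by
  by_contra! hm3
  have hsq : ∀ a : ℂ, a ^ m = 1 → a = 1 ∨ a = -1 := by
    intro a ha
    interval_cases m
    · simp at ha; exact Or.inl ha
    · exact mul_self_eq_one_iff.1 (by rw [← pow_two]; exact ha)
  obtain ⟨α, hα⟩ := hW.exists_root
  have hα0 : α ≠ 0 := by
    rintro rfl
    simpa using hα.1
  have hrefl : refl α α = -α := Submodule.reflection_orthogonalComplement_singleton_eq_neg α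
  -- When the only rotations are `±1`, every `w ∈ W` sends `α` to `±α`: an orientation-reversing `w`
  -- becomes a rotation after multiplication by `refl α`, which negates `α`.
  have hinv : ∀ w ∈ W, ∀ u ∈ (ℝ ∙ α), w u ∈ (ℝ ∙ α) := by
    intro w hw u hu
    obtain ⟨r, rfl⟩ := Submodule.mem_span_singleton.1 hu
    rw [map_smul]
    refine Submodule.smul_mem _ r ?_
    have hmem := Submodule.mem_span_singleton_self (R := ℝ) α
    obtain ⟨a, ha, h | h⟩ := isometry_eq_rotation_or_reflection e w
    · rcases hsq a ((hm a).1 ⟨w, hw, h⟩) with rfl | rfl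
      · have : w α = α := e.injective (by rw [h, one_mul])
        rwa [this]
      · have : w α = -α := e.injective (by rw [h, map_neg]; ring)
        rw [this]
        exact neg_mem hmem
    · have h1 : ∀ y, e ((w * refl α) y) = (a * -conj (e α) ^ 2) * e y := by
        intro y
        rw [isometry_mul_apply, h, e_refl_apply e hα.1]
        simp only [map_mul, map_neg, map_pow, Complex.conj_conj]
        ring
      have h2 : w α = -((w * refl α) α) := by
        rw [isometry_mul_apply, hrefl, map_neg, neg_neg]
      rw [h2]
      rcases hsq _ ((hm _).1 ⟨_, W.mul_mem hw hα.2, h1⟩) with h3 | h3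
      · have : (w * refl α) α = α := e.injective (by rw [h1, h3, one_mul])
        rw [this]
        exact neg_mem hmem
      · have : (w * refl α) α = -α := e.injective (by rw [h1, h3, map_neg]; ring)
        rw [this, neg_neg]
        exact hmem
  rcases hW.irreducible _ hinv with h | h
  · exact hα0 (Submodule.span_singleton_eq_bot.1 h)
  · have h1 := finrank_span_singleton (K := ℝ) hα0
    rw [h, finrank_top, hE] at h1
    norm_num at h1

/-- The unit vector with argument `φ`. -/
noncomputable def unitVec (φ : ℝ) : E := e.symm (exp (φ * I))

theorem e_unitVec (φ : ℝ) : e (unitVec e φ) = exp (φ * I) := by simp [unitVec]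

theorem norm_unitVec (φ : ℝ) : ‖unitVec e φ‖ = 1 := by
  rw [← e.norm_map, e_unitVec, Complex.norm_exp_ofReal_mul_I]

theorem exists_eq_unitVec {α : E} (hα : ‖α‖ = 1) : ∃ φ ∈ Set.Ioc (-Real.pi) Real.pi, α = unitVec e φ := by
  refine ⟨arg (e α), Complex.arg_mem_Ioc _, e.injective ?_⟩
  rw [e_unitVec]
  have := Complex.norm_mul_exp_arg_mul_I (e α)
  rw [e.norm_map, hα] at this
  simpa using this.symm

theorem conj_exp_mul_I (φ : ℝ) : conj (exp (φ * I)) = exp (-(φ * I)) := by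
  rw [← Complex.exp_conj]
  simp

theorem inner_unitVec (φ ψ : ℝ) : inner ℝ (unitVec e φ) (unitVec e ψ) = Real.cos (ψ - φ) := by
  rw [inner_eq_re e, e_unitVec, e_unitVec, conj_exp_mul_I, ← Complex.exp_add]
  have : -(φ * I) + ψ * I = ((ψ - φ : ℝ) : ℂ) * I := by push_cast; ring
  rw [this, Complex.exp_ofReal_mul_I_re]

theorem e_refl_unitVec (φ : ℝ) (y : E) :
    e (refl (unitVec e φ) y) = -exp (2 * φ * I) * conj (e y) := by
  rw [e_refl_apply e (norm_unitVec e φ), e_unitVec, ← Complex.exp_nat_mul]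
  push_cast
  ring_nf

theorem e_refl_refl_unitVec (φ ψ : ℝ) (y : E) :
    e ((refl (unitVec e φ) * refl (unitVec e ψ)) y) = exp (2 * (φ - ψ) * I) * e y := by
  rw [isometry_mul_apply, e_refl_unitVec, e_refl_unitVec, map_mul, map_neg,
    Complex.conj_conj, ← Complex.exp_conj]
  have : 2 * (φ - ψ) * I = 2 * φ * I + (starRingEnd ℂ) (2 * ψ * I) := by
    simp only [map_mul, map_ofNat, Complex.conj_ofReal, Complex.conj_I]
    ring
  rw [this, Complex.exp_add]
  ring

theorem unitVec_mem_roots {φ : ℝ} : unitVec e φ ∈ roots W ↔ refl (unitVec e φ) ∈ W :=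
  ⟨fun h => h.2, fun h => ⟨norm_unitVec e φ, h⟩⟩

/-- Relative to a known root at angle `φ₀`, membership is decided by the product of the two
reflections, a rotation by `2(φ - φ₀)`. -/
theorem unitVec_mem_roots_iff {m : ℕ} (hm0 : 0 < m)
    (hm : ∀ a : ℂ, (∃ g ∈ W, ∀ y, e (g y) = a * e y) ↔ a ^ m = 1) {φ₀ : ℝ}
    (h₀ : unitVec e φ₀ ∈ roots W) (φ : ℝ) :
    unitVec e φ ∈ roots W ↔ ∃ k : ℤ, φ = φ₀ + k * (Real.pi / m) := by
  have hm' : (m : ℂ) ≠ 0 := by exact_mod_cast hm0.ne'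
  have hmr : (m : ℝ) ≠ 0 := by exact_mod_cast hm0.ne'
  have h1 : unitVec e φ ∈ roots W ↔ refl (unitVec e φ) * refl (unitVec e φ₀) ∈ W := by
    rw [unitVec_mem_roots, Subgroup.mul_mem_cancel_right _ h₀.2]
  have h2 : refl (unitVec e φ) * refl (unitVec e φ₀) ∈ W ↔ exp (2 * (φ - φ₀) * I) ^ m = 1 := by
    rw [← hm]
    refine ⟨fun h => ⟨_, h, e_refl_refl_unitVec e φ φ₀⟩, ?_⟩
    rintro ⟨g, hg, h⟩
    convert hg
    ext y
    apply e.injective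
    rw [h, e_refl_refl_unitVec]
  rw [h1, h2, ← Complex.exp_nat_mul, Complex.exp_eq_one_iff]
  refine exists_congr fun k => ?_
  rw [← Complex.ofReal_inj]
  push_cast
  have hI := Complex.I_ne_zero
  constructor
  · intro h
    field_simp
    have h3 : (2 * I) * (φ * m) = (2 * I) * (φ₀ * m + k * Real.pi) := by linear_combination h
    exact mul_left_cancel₀ (mul_ne_zero two_ne_zero hI) h3
  · intro h
    rw [h]
    field_simp
    ring

end Planar

/-! ### Simple roots and Coxeter elements in the plane -/

section Planar

open Complex ComplexConjugate

variable {E : Type*} [NormedAddCommGroup E] [InnerProductSpace ℝ E]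
  {W : Subgroup (E ≃ₗᵢ[ℝ] E)} (e : E ≃ₗᵢ[ℝ] ℂ)

theorem exists_smul_of_mem_hyperplane {φ : ℝ} {y : E} (hy : y ∈ hyperplane (unitVec e φ)) :
    ∃ t : ℝ, y = t • unitVec e (φ + Real.pi / 2) := by
  rw [mem_hyperplane, inner_eq_re e, e_unitVec, conj_exp_mul_I] at hy
  refine ⟨(exp (-(φ * I)) * e y).im, e.injective ?_⟩
  have h1 : exp (-(φ * I)) * e y = ((exp (-(φ * I)) * e y).im : ℝ) * I := by
    apply Complex.ext <;> simp [hy]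
  have h2 : exp (φ * I) * exp (-(φ * I)) = 1 := by rw [← Complex.exp_add]; simp
  have h3 : exp ((φ + Real.pi / 2 : ℝ) * I) = exp (φ * I) * I := by
    push_cast
    rw [add_mul, Complex.exp_add, Complex.exp_pi_div_two_mul_I]
  rw [map_smul, e_unitVec, h3, Complex.real_smul]
  linear_combination exp (φ * I) * h1 - e y * h2

theorem inner_unitVec_add_pi_div_two (φ ψ : ℝ) :
    inner ℝ (unitVec e ψ) (unitVec e (φ + Real.pi / 2)) = Real.sin (ψ - φ) := by
  rw [inner_unitVec, ← Real.cos_pi_div_two_sub]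
  congr 1
  ring

theorem unitVec_injOn {φ ψ : ℝ} (h : unitVec e φ = unitVec e ψ) (h1 : |φ - ψ| < Real.pi) :
    φ = ψ := by
  have h2 := inner_unitVec e φ ψ
  rw [h, inner_unitVec, sub_self, Real.cos_zero, eq_comm, Real.cos_eq_one_iff_of_lt_of_lt] at h2
  · linarith
  · rw [abs_lt] at h1
    linarith [Real.pi_pos]
  · rw [abs_lt] at h1
    linarith [Real.pi_pos]

/-- The coordinate places `x` on the positive real axis, so with `δ = π/m` the positive roots have
angles `φ₀, φ₀ + δ, …, φ₀ + (π - δ)`. The two extreme ones are the walls, since the hyperplane of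
any other meets the closed chamber only in `0`. -/
theorem simpleRoots_eq {m : ℕ} (hm : 3 ≤ m) {φ₀ : ℝ}
    (hroots : ∀ φ, unitVec e φ ∈ roots W ↔ ∃ k : ℤ, φ = φ₀ + k * (Real.pi / m)) {x : E}
    (hx : x ∈ regularSet W) {r : ℝ} (hr : 0 < r)
    (hin : ∀ φ, inner ℝ (unitVec e φ) x = r * Real.cos φ) (h₁ : -(Real.pi / 2) < φ₀)
    (h₂ : φ₀ ≤ -(Real.pi / 2) + Real.pi / m) (β : E) :
    β ∈ simpleRoots W (connectedComponentIn (regularSet W) x) ↔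
      β = unitVec e φ₀ ∨ β = unitVec e (φ₀ + (Real.pi - Real.pi / m)) := by
  set δ := Real.pi / m with hδ
  have hm0 : (0 : ℝ) < m := by exact_mod_cast (by omega : 0 < m)
  have hδ0 : 0 < δ := div_pos Real.pi_pos hm0
  have hmδ : m * δ = Real.pi := by rw [hδ]; field_simp
  have hm3 : (3 : ℝ) ≤ m := by exact_mod_cast hm
  have hδ3 : 3 * δ ≤ Real.pi := by rw [← hmδ]; gcongr
  -- Equality would make `-π/2` the angle of a root orthogonal to the regular vector `x`.
  have h₂' : φ₀ < -(Real.pi / 2) + δ := by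
    refine lt_of_le_of_ne h₂ fun h => ?_
    have h3 : unitVec e (-(Real.pi / 2)) ∈ roots W := (hroots _).2 ⟨-1, by push_cast; linarith⟩
    refine mem_regularSet.1 hx _ h3 ?_
    rw [hin, Real.cos_neg, Real.cos_pi_div_two, mul_zero]
  have hpos : ∀ β, β ∈ roots W → 0 < inner ℝ β x →
      ∃ ψ, β = unitVec e ψ ∧ φ₀ ≤ ψ ∧ ψ ≤ φ₀ + (Real.pi - δ) := by
    intro β hβ hβx
    obtain ⟨ψ, ⟨hψ1, hψ2⟩, rfl⟩ := exists_eq_unitVec e hβ.1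
    rw [hin] at hβx
    have hcos : 0 < Real.cos ψ := pos_of_mul_pos_right hβx hr.le
    have h3 : ψ < Real.pi / 2 := by
      by_contra! h
      have := Real.cos_nonpos_of_pi_div_two_le_of_le h (by linarith [Real.pi_pos])
      linarith
    have h4 : -(Real.pi / 2) < ψ := by
      by_contra! h
      have := Real.cos_nonpos_of_pi_div_two_le_of_le (x := -ψ) (by linarith)
        (by linarith [Real.pi_pos])
      rw [Real.cos_neg] at this
      linarith
    obtain ⟨k, hk⟩ := (hroots ψ).1 hβ
    have hk0 : 0 ≤ k := by
      by_contra! h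
      have h5 : (k : ℝ) ≤ -1 := by exact_mod_cast (by omega : k ≤ -1)
      nlinarith
    have hkm : k ≤ m - 1 := by
      by_contra! h
      have h5 : (m : ℝ) ≤ k := by exact_mod_cast (by omega : (m : ℤ) ≤ k)
      nlinarith
    have h6 : (0 : ℝ) ≤ k := by exact_mod_cast hk0
    have h7 : (k : ℝ) ≤ m - 1 := by exact_mod_cast hkm
    exact ⟨ψ, rfl, by nlinarith, by nlinarith⟩
  have hfirst : unitVec e φ₀ ∈ roots W ∧ 0 < inner ℝ (unitVec e φ₀) x := by
    refine ⟨(hroots _).2 ⟨0, by simp⟩, ?_⟩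
    rw [hin]
    exact mul_pos hr (Real.cos_pos_of_mem_Ioo ⟨h₁, by linarith⟩)
  have hlast : unitVec e (φ₀ + (Real.pi - δ)) ∈ roots W ∧
      0 < inner ℝ (unitVec e (φ₀ + (Real.pi - δ))) x := by
    refine ⟨(hroots _).2 ⟨m - 1, by push_cast; linarith⟩, ?_⟩
    rw [hin]
    exact mul_pos hr (Real.cos_pos_of_mem_Ioo ⟨by linarith, by linarith⟩)
  -- The sign of `s` selects the ray of the hyperplane lying in the closed chamber.
  have hspan : ∀ (φ : ℝ) (s : ℝ), s ≠ 0 →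
      (∀ ψ, φ₀ ≤ ψ → ψ ≤ φ₀ + (Real.pi - δ) → 0 ≤ s * Real.sin (ψ - φ)) →
      Submodule.span ℝ ((hyperplane (unitVec e φ) : Set E) ∩
        closure (connectedComponentIn (regularSet W) x)) = hyperplane (unitVec e φ) := by
    intro φ s hs hsin
    refine le_antisymm (Submodule.span_le.2 Set.inter_subset_left) fun y hy => ?_
    obtain ⟨t, rfl⟩ := exists_smul_of_mem_hyperplane e hy
    have hmem : s • unitVec e (φ + Real.pi / 2) ∈ Submodule.span ℝ
        ((hyperplane (unitVec e φ) : Set E) ∩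
          closure (connectedComponentIn (regularSet W) x)) := by
      refine Submodule.subset_span ⟨?_, ?_⟩
      · rw [SetLike.mem_coe, mem_hyperplane, inner_smul_right, inner_unitVec_add_pi_div_two]
        simp
      · rw [closure_chamber_eq hx]
        intro β hβ hβx
        obtain ⟨ψ, rfl, h3, h4⟩ := hpos β hβ hβx
        rw [inner_smul_right, inner_unitVec_add_pi_div_two]
        exact hsin ψ h3 h4
    have := Submodule.smul_mem _ (t / s) hmem
    rwa [smul_smul, div_mul_cancel₀ _ hs] at this
  constructor
  · rintro ⟨hβ, hβspan⟩
    obtain ⟨hβ, hβx⟩ := (mem_positiveRoots hx).1 hβ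
    obtain ⟨φ, rfl, h3, h4⟩ := hpos β hβ hβx
    by_contra! hne
    have h3' : φ₀ < φ := lt_of_le_of_ne h3 fun h => hne.1 (by rw [h])
    have h4' : φ < φ₀ + (Real.pi - δ) := lt_of_le_of_ne h4 fun h => hne.2 (by rw [h])
    -- The two extreme roots have opposite signs on either ray of an intermediate hyperplane, which
    -- forces `t = 0`.
    have hbot : hyperplane (unitVec e φ) ≤ ⊥ := by
      rw [← hβspan, Submodule.span_le]
      rintro y ⟨hy, hycl⟩
      obtain ⟨t, rfl⟩ := exists_smul_of_mem_hyperplane e hy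
      rw [closure_chamber_eq hx] at hycl
      have h5 := hycl _ hfirst.1 hfirst.2
      have h6 := hycl _ hlast.1 hlast.2
      rw [inner_smul_right, inner_unitVec_add_pi_div_two] at h5 h6
      have h7 : 0 < Real.sin (φ - φ₀) :=
        Real.sin_pos_of_pos_of_lt_pi (by linarith) (by linarith)
      have h8 : 0 < Real.sin (φ₀ + (Real.pi - δ) - φ) :=
        Real.sin_pos_of_pos_of_lt_pi (by linarith) (by linarith)
      rw [← neg_sub φ φ₀, Real.sin_neg] at h5
      have h9 : t = 0 := by
        refine le_antisymm ?_ (nonneg_of_mul_nonneg_left h6 h8)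
        by_contra! h
        have := mul_pos h h7
        linarith
      simp [h9]
    have h5 : unitVec e (φ + Real.pi / 2) ∈ hyperplane (unitVec e φ) := by
      rw [mem_hyperplane, inner_unitVec_add_pi_div_two]
      simp
    have h6 := norm_unitVec e (φ + Real.pi / 2)
    rw [(Submodule.mem_bot ℝ).1 (hbot h5)] at h6
    simp at h6
  · rintro (rfl | rfl)
    · refine ⟨(mem_positiveRoots hx).2 hfirst, hspan _ 1 one_ne_zero fun ψ h3 h4 => ?_⟩
      rw [one_mul]
      exact Real.sin_nonneg_of_nonneg_of_le_pi (by linarith) (by linarith)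
    · refine ⟨(mem_positiveRoots hx).2 hlast, hspan _ (-1) (by norm_num) fun ψ h3 h4 => ?_⟩
      rw [← neg_sub, Real.sin_neg, neg_mul_neg, one_mul]
      exact Real.sin_nonneg_of_nonneg_of_le_pi (by linarith) (by linarith)

theorem eq_pair_of_nodup {A : Type*} {a b : A} (hab : a ≠ b) {l : List A} (hl : l.Nodup)
    (h : ∀ z, z ∈ l ↔ z = a ∨ z = b) : l = [a, b] ∨ l = [b, a] := by
  have h1 : l.Perm [a, b] := by
    rw [List.perm_ext_iff_of_nodup hl (by simpa using hab)]
    simpa using h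
  have hlen := h1.length_eq
  obtain ⟨p, q, rfl⟩ := List.length_eq_two.1 hlen
  have hp := (h p).1 (by simp)
  have hq := (h q).1 (by simp)
  have hpq : p ≠ q := by simpa using hl
  grind

theorem exists_rotate {s : ℂ} (hs : ‖s‖ = 1) : ∃ e' : E ≃ₗᵢ[ℝ] ℂ, ∀ y, e' y = s * e y :=
  ⟨e.trans (rotation ⟨s, mem_sphere_zero_iff_norm.2 hs⟩), fun _ => rfl⟩

theorem exists_isometry_complex (hE : Module.finrank ℝ E = 2) {x : E} (hx : x ≠ 0) :
    ∃ e : E ≃ₗᵢ[ℝ] ℂ, e x = ‖x‖ := by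
  have : FiniteDimensional ℝ E := Module.finite_of_finrank_pos (by omega)
  let e₀ : E ≃ₗᵢ[ℝ] ℂ :=
    (stdOrthonormalBasis ℝ E).equiv Complex.orthonormalBasisOneI (finCongr hE)
  have hx' : (‖x‖ : ℂ) ≠ 0 := by simpa using hx
  obtain ⟨e, he⟩ := exists_rotate e₀ (s := conj (e₀ x) / ‖x‖) (by
    have : ‖x‖ ≠ 0 := by simpa using hx
    simp [this])
  refine ⟨e, ?_⟩
  rw [he, div_mul_eq_mul_div, div_eq_iff hx', ← Complex.normSq_eq_conj_mul_self,
    Complex.normSq_eq_norm_sq, e₀.norm_map]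
  push_cast
  ring

/-- The simple roots are `π - π/m` apart, so the product of their reflections is a rotation by
`±2π/m`, with sign given by the order of the factors. The negative sign is absorbed by composing `e`
with conjugation. -/
theorem exists_rotation_form (hE : Module.finrank ℝ E = 2)
    (hW : IsIrreducibleReflectionGroup W) {c : W} (hc : IsCoxeterElement W c) :
    ∃ m : ℕ, 3 ≤ m ∧ ∃ e : E ≃ₗᵢ[ℝ] ℂ,
      (∀ a : ℂ, (∃ g ∈ W, ∀ y, e (g y) = a * e y) ↔ a ^ m = 1) ∧
      ∀ y, e ((c : E ≃ₗᵢ[ℝ] E) y) = exp (2 * Real.pi * I / m) * e y := by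
  obtain ⟨D, ⟨x, hx, rfl⟩, l, hl, hmem, hprod⟩ := hc
  obtain ⟨α, hα⟩ := hW.exists_root
  have hx0 : x ≠ 0 := by
    rintro rfl
    exact mem_regularSet.1 hx α hα (inner_zero_right _)
  obtain ⟨e, he⟩ := exists_isometry_complex hE hx0
  obtain ⟨m, hm0, hm⟩ := exists_rotation_order e hW.finite
  have hm3 := three_le_of_irreducible e hE hW hm0 hm
  have hmr : (0 : ℝ) < m := by exact_mod_cast hm0
  have hmc : (m : ℂ) ≠ 0 := by exact_mod_cast hm0.ne'
  have hδ0 : 0 < Real.pi / m := div_pos Real.pi_pos hmr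
  obtain ⟨φ, -, rfl⟩ := exists_eq_unitVec e hα.1
  -- Shifting by multiples of `π/m` moves the given root to the first angle above `-π/2`.
  obtain ⟨k, ⟨hk1, hk2⟩, -⟩ := existsUnique_add_zsmul_mem_Ioc hδ0 φ (-(Real.pi / 2))
  set φ₀ := φ + k • (Real.pi / m) with hφ₀
  have hroot₀ : unitVec e φ₀ ∈ roots W :=
    (unitVec_mem_roots_iff e hm0 hm hα φ₀).2 ⟨k, by rw [hφ₀, zsmul_eq_mul]⟩
  have hin : ∀ φ, inner ℝ (unitVec e φ) x = ‖x‖ * Real.cos φ := by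
    intro φ
    rw [inner_eq_re e, he, e_unitVec, conj_exp_mul_I, mul_comm, Complex.re_ofReal_mul,
      ← Real.cos_neg, ← Complex.exp_ofReal_mul_I_re]
    push_cast
    rw [neg_mul]
  have hsimple := simpleRoots_eq e hm3 (unitVec_mem_roots_iff e hm0 hm hroot₀) hx
    (norm_pos_iff.2 hx0) hin hk1 hk2
  have hδ3 : 3 * (Real.pi / m) ≤ Real.pi := by
    have hm3' : (3 : ℝ) ≤ m := by exact_mod_cast hm3
    rw [← mul_div_assoc, div_le_iff₀ hmr, mul_comm]
    exact mul_le_mul_of_nonneg_left hm3' Real.pi_pos.le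
  have hne : unitVec e φ₀ ≠ unitVec e (φ₀ + (Real.pi - Real.pi / m)) := by
    intro h
    have := unitVec_injOn e h (by rw [abs_lt]; constructor <;> linarith)
    linarith
  rcases eq_pair_of_nodup hne hl fun z => (hmem z).trans (hsimple z) with h | h
  · refine ⟨m, hm3, e, hm, fun y => ?_⟩
    rw [hprod, h]
    simp only [List.map_cons, List.map_nil, List.prod_cons, List.prod_nil, mul_one]
    rw [e_refl_refl_unitVec]
    congr 1
    rw [Complex.exp_eq_exp_iff_exists_int]
    -- The full turn comes from `2(φ₀ - (φ₀ + π - π/m)) = 2π/m - 2π`.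
    refine ⟨-1, ?_⟩
    push_cast
    field_simp
    ring
  · refine ⟨m, hm3, e.trans Complex.conjLIE, fun a => ?_, fun y => ?_⟩
    · have h1 : (∃ g ∈ W, ∀ y, (e.trans Complex.conjLIE) (g y) = a * (e.trans Complex.conjLIE) y) ↔
          ∃ g ∈ W, ∀ y, e (g y) = conj a * e y := by
        refine exists_congr fun g => and_congr_right fun _ => forall_congr' fun y => ?_
        simp only [LinearIsometryEquiv.coe_trans, Function.comp_apply, Complex.conjLIE_apply]
        rw [← (starRingEnd ℂ).injective.eq_iff, map_mul, Complex.conj_conj, Complex.conj_conj]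
      rw [h1, hm, ← map_pow, ← (starRingEnd ℂ).injective.eq_iff, Complex.conj_conj, map_one]
    · rw [hprod, h]
      simp only [List.map_cons, List.map_nil, List.prod_cons, List.prod_nil, mul_one]
      simp only [LinearIsometryEquiv.coe_trans, Function.comp_apply, Complex.conjLIE_apply]
      rw [e_refl_refl_unitVec, map_mul, ← Complex.exp_conj]
      congr 1
      rw [Complex.exp_eq_exp_iff_exists_int]
      refine ⟨-1, ?_⟩
      simp only [map_mul, map_sub, map_ofNat, Complex.conj_ofReal, Complex.conj_I]
      push_cast
      field_simp
      ring

/-- The normal form of the dihedral group with a chosen Coxeter element. -/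
theorem exists_dihedral_form (hE : Module.finrank ℝ E = 2)
    (hW : IsIrreducibleReflectionGroup W) {c : W} (hc : IsCoxeterElement W c) :
    3 ≤ orderOf c ∧ ∃ (e : E ≃ₗᵢ[ℝ] ℂ) (t : W),
      (∀ y, e ((c : E ≃ₗᵢ[ℝ] E) y) = omega W c * e y) ∧
      (∀ y, e ((t : E ≃ₗᵢ[ℝ] E) y) = conj (e y)) ∧
      ∀ w : W, ∃ k : ℕ, w = c ^ k ∨ w = c ^ k * t := by
  obtain ⟨m, hm3, e, hm, hce⟩ := exists_rotation_form hE hW hc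
  have hprim := Complex.isPrimitiveRoot_exp m (by omega)
  set ζ := exp (2 * Real.pi * I / m) with hζ
  have hpow : ∀ (k : ℕ) y, e (((c ^ k : W) : E ≃ₗᵢ[ℝ] E) y) = ζ ^ k * e y := by
    intro k
    induction k with
    | zero => simp
    | succ k ih =>
      intro y
      rw [pow_succ, Subgroup.coe_mul, isometry_mul_apply, ih, hce, pow_succ, mul_assoc]
  have hone : ∀ k : ℕ, c ^ k = 1 ↔ ζ ^ k = 1 := by
    intro k
    constructor
    · intro h
      have h1 := hpow k (e.symm 1)
      rw [h] at h1
      simpa using h1.symm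
    · intro h
      ext y
      apply e.injective
      rw [hpow, h, one_mul]
      rfl
  have hord : orderOf c = m := by
    refine Nat.dvd_antisymm (orderOf_dvd_of_pow_eq_one ((hone m).2 hprim.pow_eq_one)) ?_
    exact hprim.dvd_of_pow_eq_one _ ((hone _).1 (pow_orderOf_eq_one c))
  have homega : omega W c = ζ := by rw [omega, hord]
  obtain ⟨α, hα⟩ := hW.exists_root
  have hα1 : conj (e α) * e α = 1 := conj_mul_self_of_norm_one (by simpa using hα.1)
  -- This rotation puts `α` on the imaginary axis, so that `refl α` becomes complex conjugation.
  obtain ⟨e', he'⟩ := exists_rotate e (s := I * conj (e α)) (by simp [hα.1])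
  refine ⟨hord ▸ hm3, e', ⟨refl α, hα.2⟩, ?_, ?_, ?_⟩
  · intro y
    rw [he', he', hce, homega]
    ring
  · intro y
    rw [he', he', e_refl_apply e hα.1]
    simp only [map_mul, Complex.conj_I, Complex.conj_conj]
    linear_combination (-I * e α * conj (e y)) * hα1
  · intro w
    have hrot : ∀ (w : W) (a : ℂ), (∀ y, e ((w : E ≃ₗᵢ[ℝ] E) y) = a * e y) → ∃ k : ℕ, w = c ^ k := by
      intro w a ha
      have h1 := (hm a).1 ⟨w, w.2, ha⟩
      have : NeZero m := ⟨by omega⟩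
      obtain ⟨k, -, rfl⟩ := hprim.eq_pow_of_pow_eq_one h1
      refine ⟨k, ?_⟩
      ext y
      apply e.injective
      rw [ha, hpow]
    obtain ⟨a, -, h | h⟩ := isometry_eq_rotation_or_reflection e (w : E ≃ₗᵢ[ℝ] E)
    · obtain ⟨k, hk⟩ := hrot w a h
      exact ⟨k, Or.inl hk⟩
    · obtain ⟨k, hk⟩ := hrot (w * ⟨refl α, hα.2⟩) (a * -conj (e α) ^ 2) fun y => by
        rw [Subgroup.coe_mul, isometry_mul_apply, h, e_refl_apply e hα.1]
        simp only [map_mul, map_neg, map_pow, Complex.conj_conj]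
        ring
      refine ⟨k, Or.inr ?_⟩
      rw [← hk, mul_assoc, IsReflection.mul_self W ⟨α, hα, rfl⟩, mul_one]

end Planar

/-! ### Forms of degree h + 1 with the weight of a coordinate -/

section Coefficients

open MvPolynomial

theorem coeff_aeval_C_mul_X {σ : Type*} [Fintype σ] (a : σ → ℂ) (p : MvPolynomial σ ℂ)
    (d : σ →₀ ℕ) :
    coeff d (aeval (fun i => C (a i) * X i) p) = (∏ i, a i ^ d i) * coeff d p := by
  induction p using MvPolynomial.induction_on' with
  | monomial u r =>
    classical
    have h : aeval (fun i => C (a i) * X i) (monomial u r) =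
        monomial u ((∏ i, a i ^ u i) * r) := by
      rw [aeval_monomial, monomial_eq, Finsupp.prod_fintype _ _ (by simp),
        Finsupp.prod_fintype _ _ (by simp), algebraMap_eq]
      simp only [mul_pow, Finset.prod_mul_distrib, map_mul, map_prod, map_pow]
      ring
    rw [h, coeff_monomial, coeff_monomial]
    split_ifs with hu
    · rw [hu]
    · simp
  | add p q hp hq => rw [map_add, coeff_add, hp, hq, coeff_add, mul_add]

/-- The exponent of the monomial `X₀ ^ i * X₁ ^ j`. -/
noncomputable def expo (i j : ℕ) : Fin 2 →₀ ℕ := Finsupp.single 0 i + Finsupp.single 1 j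

theorem expo_zero (i j : ℕ) : expo i j 0 = i := by simp [expo]

theorem expo_one (i j : ℕ) : expo i j 1 = j := by simp [expo]

theorem eq_expo (d : Fin 2 →₀ ℕ) : d = expo (d 0) (d 1) := by
  ext i
  fin_cases i
  · exact (expo_zero _ _).symm
  · exact (expo_one _ _).symm

theorem monomial_expo (i j : ℕ) (r : ℂ) :
    monomial (expo i j) r = C r * (X 0 ^ i * X 1 ^ j) := by
  rw [monomial_eq, Finsupp.prod_fintype _ _ (by simp), Fin.prod_univ_two, expo_zero, expo_one]

theorem degree_eq_of_coeff_ne_zero {p : MvPolynomial (Fin 2) ℂ} {k : ℕ} (hp : p.IsHomogeneous k)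
    {d : Fin 2 →₀ ℕ} (hd : coeff d p ≠ 0) : d 0 + d 1 = k := by
  rw [← hp hd, Finsupp.weight_apply, Finsupp.sum_fintype _ _ (by simp), Fin.sum_univ_two]
  simp

/-- A form of degree `h + 1` which is an eigenvector of the rotation with the eigenvalue of `X₀`. -/
theorem eq_of_rotation_eigenvector {h : ℕ} (h3 : 3 ≤ h) {ω : ℂ} (hω : IsPrimitiveRoot ω h)
    {p : MvPolynomial (Fin 2) ℂ} (hp : p.IsHomogeneous (h + 1))
    (hrot : aeval (fun i => C (![ω, ω⁻¹] i) * X i) p = ω • p) :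
    ∃ A B C' : ℂ, (B = 0 ∨ 2 * (h / 2) = h) ∧
      p = C A * X 0 ^ (h + 1) + C B * (X 0 ^ (h / 2 + 1) * X 1 ^ (h / 2)) +
        C C' * (X 0 * X 1 ^ h) := by
  classical
  have hω0 : ω ≠ 0 := hω.ne_zero (by omega)
  have hsupp : ∀ d, coeff d p ≠ 0 →
      d = expo (h + 1) 0 ∨ d = expo (h / 2 + 1) (h / 2) ∨ d = expo 1 h := by
    intro d hd
    have h1 := degree_eq_of_coeff_ne_zero hp hd
    have h2 := congrArg (coeff d) hrot
    rw [coeff_aeval_C_mul_X, Fin.prod_univ_two, coeff_smul, smul_eq_mul] at h2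
    have h3' := mul_right_cancel₀ hd h2
    simp only [Matrix.cons_val_zero, Matrix.cons_val_one, inv_pow] at h3'
    have h4 : ω ^ d 0 = ω ^ (d 1 + 1) := by
      rw [mul_inv_eq_iff_eq_mul₀ (pow_ne_zero _ hω0)] at h3'
      rw [h3', pow_succ']
    have h5 : d 0 ≡ d 1 + 1 [MOD h] := by
      have h6 := (hω.isUnit_unit (by omega)).eq_orderOf
      rw [h6, ← pow_eq_pow_iff_modEq]
      ext
      simpa using h4
    have h6 : (h : ℤ) ∣ ((d 1 + 1 : ℕ) : ℤ) - (d 0 : ℕ) := h5.dvd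
    obtain ⟨k, hk⟩ := h6
    -- Combines the weight condition `d 1 + 1 - d 0 = h k` with the degree condition `d 0 + d 1 = h
    -- + 1`. As `0 ≤ d 1 ≤ h + 1` and `h ≥ 3`, only `k = -1, 0, 1` survive.
    have h7 : (2 * (d 1) : ℤ) = h * (k + 1) := by
      push_cast at hk
      have : (d 0 : ℤ) + d 1 = h + 1 := by exact_mod_cast h1
      linarith
    have hk0 : -1 ≤ k := by
      by_contra! hlt
      have : (h : ℤ) * (k + 1) ≤ h * (-1) := by
        apply mul_le_mul_of_nonneg_left <;> omega
      omega
    have hk1 : k ≤ 1 := by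
      by_contra! hlt
      have : (h : ℤ) * 3 ≤ h * (k + 1) := by
        apply mul_le_mul_of_nonneg_left <;> omega
      omega
    rw [eq_expo d]
    obtain rfl | rfl | rfl : k = -1 ∨ k = 0 ∨ k = 1 := by omega
    · left
      congr 1 <;> omega
    · right; left
      congr 1 <;> omega
    · right; right
      congr 1 <;> omega
  refine ⟨coeff (expo (h + 1) 0) p, coeff (expo (h / 2 + 1) (h / 2)) p, coeff (expo 1 h) p, ?_, ?_⟩
  -- For odd `h` this exponent has total degree `h`, not `h + 1`, so its coefficient vanishes.
  · by_cases hB : coeff (expo (h / 2 + 1) (h / 2)) p = 0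
    · exact Or.inl hB
    · right
      have := degree_eq_of_coeff_ne_zero hp hB
      rw [expo_zero, expo_one] at this
      omega
  · have hne : ∀ i j i' j', j ≠ j' → expo i j ≠ expo i' j' := by
      intro i j i' j' hj he
      have := DFunLike.congr_fun he 1
      rw [expo_one, expo_one] at this
      exact hj this
    have hsub : p.support ⊆ {expo (h + 1) 0, expo (h / 2 + 1) (h / 2), expo 1 h} := by
      intro d hd
      simpa using hsupp d (mem_support_iff.1 hd)
    conv_lhs => rw [← support_sum_monomial_coeff p]
    rw [Finset.sum_subset hsub (fun d _ hd => by rw [notMem_support_iff.1 hd, monomial_zero]),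
      Finset.sum_insert, Finset.sum_pair]
    · simp only [monomial_expo]
      ring
    · exact hne _ _ _ _ (by omega)
    · simp only [Finset.mem_insert, Finset.mem_singleton, not_or]
      exact ⟨hne _ _ _ _ (by omega), hne _ _ _ _ (by omega)⟩

end Coefficients

/-! ### Solving the equations and counting the solutions -/

section Numeric

/-- The equations of `V^Θ` in the eigencoordinates of the rotations. -/
theorem solution_iff {h k : ℕ} (h0 : h ≠ 0) (hk0 : k ≠ 0) {A B C : ℂ} (hB : B = 0 ∨ 2 * k = h)
    (hAC : A ≠ C) (u w : ℂ) :
    (A * u ^ (h + 1) + B * (u ^ (k + 1) * w ^ k) + C * (u * w ^ h) = u ∧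
      A * w ^ (h + 1) + B * (w ^ (k + 1) * u ^ k) + C * (w * u ^ h) = w) ↔
    (u = 0 ∧ w = 0) ∨ (w = 0 ∧ A * u ^ h = 1) ∨ (u = 0 ∧ A * w ^ h = 1) ∨
      ∃ η : ℂ, η ^ h = 1 ∧ u = η * w ∧ (A + C + B * η ^ k) * w ^ h = 1 := by
  have hBw : ∀ w : ℂ, B * (w ^ k * w ^ k) = B * w ^ h := by
    intro w
    rcases hB with rfl | hB
    · simp
    · rw [← pow_add, ← two_mul, hB]
  constructor
  · rintro ⟨h1, h2⟩
    by_cases hu : u = 0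
    · subst hu
      by_cases hw : w = 0
      · exact Or.inl ⟨rfl, hw⟩
      · right; right; left
        refine ⟨rfl, mul_left_cancel₀ hw ?_⟩
        simp only [zero_pow h0, zero_pow hk0] at h2
        linear_combination h2
    · by_cases hw : w = 0
      · subst hw
        right; left
        refine ⟨rfl, mul_left_cancel₀ hu ?_⟩
        simp only [zero_pow h0, zero_pow hk0] at h1
        linear_combination h1
      · right; right; right
        have e1 : A * u ^ h + B * (u ^ k * w ^ k) + C * w ^ h = 1 :=
          mul_left_cancel₀ hu (by linear_combination h1)
        have e2 : A * w ^ h + B * (u ^ k * w ^ k) + C * u ^ h = 1 :=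
          mul_left_cancel₀ hw (by linear_combination h2)
        -- The difference of the two equations loses its middle term and factors as `(A - C)(u^h -
        -- w^h) = 0`.
        have e3 : u ^ h = w ^ h := by
          have : (A - C) * (u ^ h - w ^ h) = 0 := by linear_combination e1 - e2
          exact sub_eq_zero.1 ((mul_eq_zero.1 this).resolve_left (sub_ne_zero.2 hAC))
        refine ⟨u / w, ?_, (div_mul_cancel₀ u hw).symm, ?_⟩
        · rw [div_pow, e3, div_self (pow_ne_zero _ hw)]
        · have e4 : (u / w) ^ k * w ^ k = u ^ k := by rw [← mul_pow, div_mul_cancel₀ _ hw]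
          rw [← e2, e3, ← e4]
          linear_combination -(u / w) ^ k * hBw w
  · rintro (⟨rfl, rfl⟩ | ⟨rfl, h1⟩ | ⟨rfl, h1⟩ | ⟨η, hη, rfl, h1⟩)
    · simp
    · simp only [zero_pow h0, zero_pow hk0]
      refine ⟨?_, by ring⟩
      linear_combination u * h1
    · simp only [zero_pow h0, zero_pow hk0]
      refine ⟨by ring, ?_⟩
      linear_combination w * h1
    · have e1 := hBw w
      constructor
      · rw [mul_pow, mul_pow, pow_succ η h, hη]
        linear_combination η * w * h1 + η * w * η ^ k * e1
      · rw [mul_pow, mul_pow, hη]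
        linear_combination w * h1 + w * η ^ k * e1

/-- The Jacobian determinant of the equations of `V^Θ` does not vanish at a solution. -/
theorem jacobian_ne_zero {h k : ℕ} (h0 : h ≠ 0) (hk0 : k ≠ 0) {A B C : ℂ}
    (hB : B = 0 ∨ 2 * k = h) (hAC : A ≠ C) (u w : ℂ)
    (hs : (u = 0 ∧ w = 0) ∨ (w = 0 ∧ A * u ^ h = 1) ∨ (u = 0 ∧ A * w ^ h = 1) ∨
      ∃ η : ℂ, η ^ h = 1 ∧ u = η * w ∧ (A + C + B * η ^ k) * w ^ h = 1) :
    (A * ((h + 1) * u ^ h) + B * ((k + 1) * u ^ k * w ^ k) + C * w ^ h - 1) *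
        (A * ((h + 1) * w ^ h) + B * ((k + 1) * w ^ k * u ^ k) + C * u ^ h - 1) -
      (B * (u ^ (k + 1) * (k * w ^ (k - 1))) + C * (u * (h * w ^ (h - 1)))) *
        (B * (w ^ (k + 1) * (k * u ^ (k - 1))) + C * (w * (h * u ^ (h - 1)))) ≠ 0 := by
  have hBw : ∀ w : ℂ, B * (w ^ k * w ^ k) = B * w ^ h := by
    intro w
    rcases hB with rfl | hB
    · simp
    · rw [← pow_add, ← two_mul, hB]
  have hh : (h : ℂ) ≠ 0 := by exact_mod_cast h0
  -- On an axis the determinant is `h (C z^h - 1)`.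
  have hne : ∀ z : ℂ, A * z ^ h = 1 → C * z ^ h - 1 ≠ 0 := by
    intro z hz hz'
    refine hAC (mul_right_cancel₀ (b := z ^ h) ?_ (by linear_combination hz - hz'))
    intro h1
    simp [h1] at hz
  rcases hs with ⟨rfl, rfl⟩ | ⟨rfl, h1⟩ | ⟨rfl, h1⟩ | ⟨η, hη, rfl, h1⟩
  · simp [h0, hk0]
  · simp only [zero_pow h0, zero_pow hk0]
    have e : A * ((h + 1) * u ^ h) = h + 1 := by linear_combination (h + 1) * h1
    simp only [e, mul_zero, zero_add, add_zero, zero_mul, zero_pow (Nat.succ_ne_zero k), sub_zero,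
      add_sub_cancel_right]
    exact mul_ne_zero hh (hne u h1)
  · simp only [zero_pow h0, zero_pow hk0]
    have e : A * ((h + 1) * w ^ h) = h + 1 := by linear_combination (h + 1) * h1
    simp only [e, mul_zero, zero_add, add_zero, zero_mul, zero_pow (Nat.succ_ne_zero k), sub_zero,
      add_sub_cancel_right]
    exact mul_ne_zero (hne w h1) hh
  · have hw : w ≠ 0 := by
      rintro rfl
      simp [h0] at h1
    obtain ⟨h', rfl⟩ : ∃ h', h = h' + 1 := ⟨h - 1, by omega⟩
    obtain ⟨k', rfl⟩ : ∃ k', k = k' + 1 := ⟨k - 1, by omega⟩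
    set s := w ^ (h' + 1) with hs
    set ε := η ^ (k' + 1) with hε
    -- On the line `u = η w` the matrix is `s` times `[[P, ηQ], [η⁻¹Q, P]]`, where `P = hA + kBε`
    -- and `Q = hC + kBε`. Since `2kB = hB`, its determinant is `s² (P - Q)(P + Q) = h² s² (A - C)(A
    -- + C + Bε) = h² s (A - C)`.
    have e1 : A * (((h' + 1 : ℕ) + 1) * (η * w) ^ (h' + 1)) +
        B * (((k' + 1 : ℕ) + 1) * (η * w) ^ (k' + 1) * w ^ (k' + 1)) + C * s - 1 =
        s * ((h' + 1) * A + (k' + 1) * (B * ε)) := by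
      rw [mul_pow, mul_pow, hη]
      push_cast
      linear_combination (k' + 2) * ε * hBw w + h1
    have e2 : A * (((h' + 1 : ℕ) + 1) * s) +
        B * (((k' + 1 : ℕ) + 1) * w ^ (k' + 1) * (η * w) ^ (k' + 1)) +
          C * (η * w) ^ (h' + 1) - 1 = s * ((h' + 1) * A + (k' + 1) * (B * ε)) := by
      rw [mul_pow, mul_pow, hη]
      push_cast
      linear_combination (k' + 2) * ε * hBw w + h1
    have e3 : B * ((η * w) ^ (k' + 1 + 1) * ((k' + 1 : ℕ) * w ^ k')) +
        C * (η * w * ((h' + 1 : ℕ) * w ^ h')) = η * s * ((h' + 1) * C + (k' + 1) * (B * ε)) := by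
      rw [mul_pow, hs, hε]
      push_cast
      linear_combination η * ε * (k' + 1) * hBw w
    -- The factor `η` completes `η ^ k'` to `ε` and `η ^ h'` to `1`.
    have e4 : η * (B * (w ^ (k' + 1 + 1) * ((k' + 1 : ℕ) * (η * w) ^ k')) +
        C * (w * ((h' + 1 : ℕ) * (η * w) ^ h'))) = s * ((h' + 1) * C + (k' + 1) * (B * ε)) := by
      rw [mul_pow, mul_pow, hs, hε]
      push_cast
      linear_combination ε * (k' + 1) * hBw w + C * w ^ (h' + 1) * (h' + 1) * hη
    have hBk : 2 * (k' + 1) * B = (h' + 1) * B := by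
      rcases hB with rfl | hB
      · simp
      · have : (2 * (k' + 1) : ℂ) = h' + 1 := by exact_mod_cast hB
        rw [this]
    have hfin : ((h' + 1 : ℕ) : ℂ) ^ 2 * s * (A - C) ≠ 0 :=
      mul_ne_zero (mul_ne_zero (pow_ne_zero _ hh) (pow_ne_zero _ hw)) (sub_ne_zero.2 hAC)
    simp only [Nat.add_sub_cancel]
    rw [e1, e2, e3]
    convert hfin using 1
    push_cast at e4 ⊢
    linear_combination (-s * ((h' + 1) * C + (k' + 1) * (B * ε))) * e4 +
      (s ^ 2 * (h' + 1) * (A - C) * ε) * hBk + ((h' + 1) ^ 2 * s * (A - C)) * h1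

/-- The points of `V^Θ`, up to scaling by powers of `ω`. -/
def pointFamily {h : ℕ} (ω a : ℂ) (y : ℂ → ℂ) :
    Option (Option (Option (Fin h)) × Fin h) → Fin 2 → ℂ
  | none => ![0, 0]
  | some (none, j) => ![ω ^ (j : ℕ) * a, 0]
  | some (some none, j) => ![0, ω ^ (j : ℕ) * a]
  | some (some (some i), j) =>
    ![ω ^ (i : ℕ) * (ω ^ (j : ℕ) * y (ω ^ (i : ℕ))), ω ^ (j : ℕ) * y (ω ^ (i : ℕ))]

theorem pointFamily_injective {h : ℕ} {ω a : ℂ} {y : ℂ → ℂ} (hω : IsPrimitiveRoot ω h)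
    (h0 : h ≠ 0) (ha : a ≠ 0) (hy : ∀ η, η ^ h = 1 → y η ≠ 0) :
    Function.Injective (pointFamily (h := h) ω a y) := by
  have hω0 : ω ≠ 0 := hω.ne_zero h0
  have hpow : ∀ j : ℕ, ω ^ j ≠ 0 := fun j => pow_ne_zero _ hω0
  have hy' : ∀ i : ℕ, y (ω ^ i) ≠ 0 := fun i =>
    hy _ (by rw [← pow_mul, mul_comm, pow_mul, hω.pow_eq_one, one_pow])
  have hinj : ∀ i j : Fin h, ω ^ (i : ℕ) = ω ^ (j : ℕ) → i = j := fun i j hij =>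
    Fin.ext (hω.pow_inj i.2 j.2 hij)
  intro p q hpq
  have e0 := congrFun hpq 0
  have e1 := congrFun hpq 1
  clear hpq
  rcases p with _ | ⟨_ | _ | i, j⟩ <;> rcases q with _ | ⟨_ | _ | i', j'⟩ <;>
    simp only [pointFamily, Matrix.cons_val_zero, Matrix.cons_val_one, mul_eq_zero, hpow, ha, hy',
      or_self, zero_eq_mul] at e0 e1 ⊢
  · rw [hinj _ _ (mul_right_cancel₀ ha e0)]
  · rw [hinj _ _ (mul_right_cancel₀ ha e1)]
  · rw [e1] at e0
    have h1 := hinj _ _ (mul_right_cancel₀ (mul_ne_zero (hpow _) (hy' _)) e0)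
    subst h1
    rw [hinj _ _ (mul_right_cancel₀ (hy' _) e1)]

theorem exists_pow_mul_of_pow_eq {h : ℕ} (h0 : h ≠ 0) {ω : ℂ} (hω : IsPrimitiveRoot ω h) {r a z : ℂ}
    (ha : r * a ^ h = 1) (hz : r * z ^ h = 1) : ∃ j < h, z = ω ^ j * a := by
  have hr : r ≠ 0 := by rintro rfl; simp at ha
  have ha0 : a ≠ 0 := by rintro rfl; simp [h0] at ha
  have h1 : (z / a) ^ h = 1 := by
    rw [div_pow, div_eq_one_iff_eq (pow_ne_zero _ ha0)]
    exact mul_left_cancel₀ hr (hz.trans ha.symm)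
  have : NeZero h := ⟨h0⟩
  obtain ⟨j, hj, hj'⟩ := hω.eq_pow_of_pow_eq_one h1
  exact ⟨j, hj, by rw [hj', div_mul_cancel₀ _ ha0]⟩

/-- The index type of `pointFamily` has `1 + (h + 2) h = (h + 1)²` elements: the origin, and `h`
multiples of one point on each of the two axes and the `h` lines `z 0 = η * z 1`. -/
theorem encard_solutions {h : ℕ} (h0 : h ≠ 0) {ω : ℂ} (hω : IsPrimitiveRoot ω h) {A : ℂ} (hA : A ≠ 0)
    {s : ℂ → ℂ} (hs : ∀ η, η ^ h = 1 → s η ≠ 0) (S : Set (Fin 2 → ℂ))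
    (hS : ∀ z, z ∈ S ↔ (z 0 = 0 ∧ z 1 = 0) ∨ (z 1 = 0 ∧ A * z 0 ^ h = 1) ∨
      (z 0 = 0 ∧ A * z 1 ^ h = 1) ∨
        ∃ η : ℂ, η ^ h = 1 ∧ z 0 = η * z 1 ∧ s η * z 1 ^ h = 1) :
    S.encard = (((h + 1) ^ 2 : ℕ) : ℕ∞) := by
  have hroot : ∀ r : ℂ, ∃ a : ℂ, r ≠ 0 → r * a ^ h = 1 := by
    intro r
    obtain ⟨a, ha⟩ := IsAlgClosed.exists_pow_nat_eq r⁻¹ (Nat.pos_of_ne_zero h0)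
    exact ⟨a, fun hr => by rw [ha, mul_inv_cancel₀ hr]⟩
  choose Y hY using hroot
  have hωh : ∀ j : ℕ, (ω ^ j) ^ h = 1 := fun j => by
    rw [← pow_mul, mul_comm, pow_mul, hω.pow_eq_one, one_pow]
  have hY0 : ∀ r, r ≠ 0 → Y r ≠ 0 := by
    intro r hr h1
    have := hY r hr
    simp [h1, h0] at this
  have hrange : S = Set.range (pointFamily (h := h) ω (Y A) fun η => Y (s η)) := by
    ext z
    rw [hS, Set.mem_range]
    have hz : ∀ p q : ℂ, ![p, q] = z ↔ p = z 0 ∧ q = z 1 := fun p q => by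
      rw [funext_iff, Fin.forall_fin_two]; simp
    constructor
    · rintro (⟨h1, h2⟩ | ⟨h1, h2⟩ | ⟨h1, h2⟩ | ⟨η, hη, h1, h2⟩)
      · exact ⟨none, (hz _ _).2 ⟨h1.symm, h2.symm⟩⟩
      · obtain ⟨j, hj, hj'⟩ := exists_pow_mul_of_pow_eq h0 hω (hY A hA) h2
        exact ⟨some (none, ⟨j, hj⟩), (hz _ _).2 ⟨hj'.symm, h1.symm⟩⟩
      · obtain ⟨j, hj, hj'⟩ := exists_pow_mul_of_pow_eq h0 hω (hY A hA) h2
        exact ⟨some (some none, ⟨j, hj⟩), (hz _ _).2 ⟨h1.symm, hj'.symm⟩⟩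
      · obtain ⟨j, hj, hj'⟩ := exists_pow_mul_of_pow_eq h0 hω (hY _ (hs η hη)) h2
        have : NeZero h := ⟨h0⟩
        obtain ⟨i, hi, rfl⟩ := hω.eq_pow_of_pow_eq_one hη
        refine ⟨some (some (some ⟨i, hi⟩), ⟨j, hj⟩), (hz _ _).2 ⟨?_, hj'.symm⟩⟩
        rw [h1, hj']
    · rintro ⟨p, rfl⟩
      rcases p with _ | ⟨_ | _ | i, j⟩
      · left
        simp [pointFamily]
      · right; left
        simp [pointFamily, mul_pow, hωh, hY A hA]
      · right; right; left
        simp [pointFamily, mul_pow, hωh, hY A hA]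
      · right; right; right
        refine ⟨ω ^ (i : ℕ), hωh _, by simp [pointFamily], ?_⟩
        simp [pointFamily, mul_pow, hωh, hY _ (hs _ (hωh i))]
  rw [hrange, ← Set.image_univ, Set.InjOn.encard_image
    (pointFamily_injective hω h0 (hY0 A hA) fun η hη => hY0 _ (hs η hη)).injOn, Set.encard_univ,
    ENat.card_eq_coe_fintype_card]
  congr 1
  simp only [Fintype.card_option, Fintype.card_prod, Fintype.card_fin]
  ring

end Numeric

/-! ### Reflecting lines and eigencoordinates -/

section RankTwo

open ComplexConjugate

variable {E : Type*} [NormedAddCommGroup E] [InnerProductSpace ℝ E]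
  {W : Subgroup (E ≃ₗᵢ[ℝ] E)} (e : E ≃ₗᵢ[ℝ] ℂ)

/-- The line (or point) where `e y = η * conj (e y)`. -/
def line (η : ℂ) : Submodule ℝ E where
  carrier := {y | e y = η * conj (e y)}
  add_mem' := by
    intro a b ha hb
    simp only [Set.mem_ofPred_eq, map_add] at *
    rw [mul_add, ← ha, ← hb]
  zero_mem' := by simp
  smul_mem' := by
    intro r a ha
    simp only [Set.mem_ofPred_eq, map_smul, Complex.real_smul, map_mul, Complex.conj_ofReal] at *
    rw [mul_left_comm, ← ha]

theorem mem_line {η : ℂ} {y : E} : y ∈ line e η ↔ e y = η * conj (e y) := Iff.rfl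

theorem exists_norm_one_sq_eq {η : ℂ} (hη : ‖η‖ = 1) : ∃ s : ℂ, ‖s‖ = 1 ∧ s ^ 2 = η := by
  obtain ⟨s, hs⟩ := IsAlgClosed.exists_pow_nat_eq η (n := 2) (by norm_num)
  refine ⟨s, ?_, hs⟩
  have h1 : ‖s‖ ^ 2 = 1 := by rw [← norm_pow, hs, hη]
  exact (pow_eq_one_iff_of_nonneg (norm_nonneg s) two_ne_zero).1 h1

/-- A square root `s` of `η` has norm `1`, so `s = η * conj s`. -/
theorem exists_mem_line {η : ℂ} (hη : ‖η‖ = 1) : ∃ y ∈ line e η, y ≠ 0 := by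
  obtain ⟨s, hs, hs2⟩ := exists_norm_one_sq_eq hη
  refine ⟨e.symm s, ?_, fun h => ?_⟩
  · rw [mem_line, LinearIsometryEquiv.apply_symm_apply]
    linear_combination (-s) * conj_mul_self_of_norm_one hs + conj s * hs2
  · have : s = 0 := by simpa using congrArg e h
    simp [this] at hs

theorem eq_of_mem_line {η η' : ℂ} {y : E} (hy : y ≠ 0) (h : y ∈ line e η) (h' : y ∈ line e η') :
    η = η' := by
  have h1 : conj (e y) ≠ 0 := by simpa using hy
  exact mul_right_cancel₀ h1 (h.symm.trans h')

theorem line_injective {η η' : ℂ} (hη : ‖η‖ = 1) (h : line e η = line e η') : η = η' := by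
  obtain ⟨y, hy, hy0⟩ := exists_mem_line e hη
  exact eq_of_mem_line e hy0 hy (h ▸ hy)

theorem line_ne_bot {η : ℂ} (hη : ‖η‖ = 1) : line e η ≠ ⊥ := by
  intro h
  obtain ⟨y, hy, hy0⟩ := exists_mem_line e hη
  rw [h] at hy
  exact hy0 hy

theorem line_ne_top {η : ℂ} (hη : ‖η‖ = 1) : line e η ≠ ⊤ := by
  intro h
  obtain ⟨y, hy, hy0⟩ := exists_mem_line e (η := -η) (by simpa using hη)
  have h1 := eq_of_mem_line e hy0 (h ▸ trivial : y ∈ line e η) hy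
  rw [self_eq_neg.1 h1] at hη
  simp at hη

/-- By `e_refl_apply`, a unit normal is given by a square root of `-η`. -/
theorem exists_root_of_reflection {w : W} {η : ℂ} (hη : ‖η‖ = 1)
    (hw : ∀ y, e ((w : E ≃ₗᵢ[ℝ] E) y) = η * conj (e y)) :
    ∃ α ∈ roots W, (w : E ≃ₗᵢ[ℝ] E) = refl α ∧ hyperplane α = line e η := by
  obtain ⟨s, hs, hs2⟩ := exists_norm_one_sq_eq (η := -η) (by simpa using hη)
  have hα : ‖e.symm s‖ = 1 := by simpa using hs
  have hrefl : (w : E ≃ₗᵢ[ℝ] E) = refl (e.symm s) := eq_refl_of_apply e hα fun y => by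
    rw [hw, LinearIsometryEquiv.apply_symm_apply, hs2, neg_neg]
  refine ⟨e.symm s, ⟨hα, hrefl ▸ w.2⟩, hrefl, ?_⟩
  ext y
  rw [mem_line, ← hw, e.injective.eq_iff, hrefl, refl, eq_comm (a := y),
    Submodule.reflection_eq_self_iff]
  rfl

theorem IsFlat.inf {X Y : Submodule ℝ E} (hX : IsFlat W X) (hY : IsFlat W Y) :
    IsFlat W (X ⊓ Y) := by
  obtain ⟨S, hS, rfl⟩ := hX
  obtain ⟨T, hT, rfl⟩ := hY
  exact ⟨S ∪ T, Set.union_subset hS hT, iInf_union.symm⟩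

theorem isFlat_hyperplane {α : E} (hα : α ∈ roots W) : IsFlat W (hyperplane α) :=
  ⟨{α}, by simpa using hα, by simp⟩

/-- The complex-linear extensions of `e` and of its conjugate; evaluation at `1` and `I` separates
them. -/
theorem exists_eigenBasis [FiniteDimensional ℝ E] (hE : Module.finrank ℝ E = 2) :
    ∃ b : Module.Basis (Fin 2) ℂ (Module.Dual ℂ (ℂ ⊗[ℝ] E)),
      (∀ z y, b 0 (z ⊗ₜ y) = z * e y) ∧ ∀ z y, b 1 (z ⊗ₜ y) = z * conj (e y) := by
  let u : Module.Dual ℂ (ℂ ⊗[ℝ] E) :=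
    LinearMap.liftBaseChange ℂ (e.toLinearEquiv : E →ₗ[ℝ] ℂ)
  let u' : Module.Dual ℂ (ℂ ⊗[ℝ] E) :=
    LinearMap.liftBaseChange ℂ ((e.trans Complex.conjLIE).toLinearEquiv : E →ₗ[ℝ] ℂ)
  have hu : ∀ z y, u (z ⊗ₜ y) = z * e y := fun z y => rfl
  have hu' : ∀ z y, u' (z ⊗ₜ y) = z * conj (e y) := fun z y => rfl
  have hli : LinearIndependent ℂ ![u, u'] := by
    rw [LinearIndependent.pair_iff]
    intro a b hab
    have h1 := LinearMap.congr_fun hab (1 ⊗ₜ e.symm 1)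
    have h2 := LinearMap.congr_fun hab (1 ⊗ₜ e.symm Complex.I)
    simp only [LinearMap.add_apply, LinearMap.smul_apply, hu, hu', smul_eq_mul,
      LinearIsometryEquiv.apply_symm_apply, map_one, mul_one, one_mul, LinearMap.zero_apply,
      Complex.conj_I] at h1 h2
    have h3 : a - b = 0 := mul_right_cancel₀ Complex.I_ne_zero (by linear_combination h2)
    constructor
    · linear_combination (h1 + h3) / 2
    · linear_combination (h1 - h3) / 2
  have hcard : Fintype.card (Fin 2) = Module.finrank ℂ (Module.Dual ℂ (ℂ ⊗[ℝ] E)) := by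
    rw [Subspace.dual_finrank_eq, Module.finrank_baseChange, hE, Fintype.card_fin]
  refine ⟨basisOfLinearIndependentOfCardEqFinrank hli hcard, ?_, ?_⟩
  · intro z y
    rw [coe_basisOfLinearIndependentOfCardEqFinrank]
    exact hu z y
  · intro z y
    rw [coe_basisOfLinearIndependentOfCardEqFinrank]
    exact hu' z y

theorem conj_eq_inv_of_pow {h : ℕ} (h0 : h ≠ 0) {η : ℂ} (hη : η ^ h = 1) :
    ‖η‖ = 1 ∧ conj η = η⁻¹ := by
  have h1 := Complex.norm_eq_one_of_pow_eq_one hη h0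
  refine ⟨h1, ?_⟩
  exact eq_inv_of_mul_eq_one_left (conj_mul_self_of_norm_one h1)

end RankTwo

/-! ### The shape of Θ in eigencoordinates -/

section Eigencoordinates

open ComplexConjugate

variable {E : Type*} [NormedAddCommGroup E] [InnerProductSpace ℝ E]
  {W : Subgroup (E ≃ₗᵢ[ℝ] E)} {e : E ≃ₗᵢ[ℝ] ℂ}
  {b : Module.Basis (Fin 2) ℂ (Module.Dual ℂ (ℂ ⊗[ℝ] E))}

theorem eigen_rotation (hb₀ : ∀ z y, b 0 (z ⊗ₜ y) = z * e y)
    (hb₁ : ∀ z y, b 1 (z ⊗ₜ y) = z * conj (e y)) {w : W} {a : ℂ}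
    (hw : ∀ y, e ((w : E ≃ₗᵢ[ℝ] E) y) = a * e y) (v : ℂ ⊗[ℝ] E) :
    b 0 (complexAct W w v) = a * b 0 v ∧ b 1 (complexAct W w v) = conj a * b 1 v := by
  induction v with
  | zero => simp
  | tmul z y =>
    rw [complexAct_tmul, hb₀, hb₀, hb₁, hb₁, hw, map_mul]
    constructor <;> ring
  | add p q hp hq =>
    simp only [map_add, hp.1, hp.2, hq.1, hq.2, mul_add, and_self]

theorem eigen_reflection (hb₀ : ∀ z y, b 0 (z ⊗ₜ y) = z * e y)
    (hb₁ : ∀ z y, b 1 (z ⊗ₜ y) = z * conj (e y)) {w : W}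
    (hw : ∀ y, e ((w : E ≃ₗᵢ[ℝ] E) y) = conj (e y)) (v : ℂ ⊗[ℝ] E) :
    b 0 (complexAct W w v) = b 1 v ∧ b 1 (complexAct W w v) = b 0 v := by
  induction v with
  | zero => simp
  | tmul z y =>
    rw [complexAct_tmul, hb₀, hb₀, hb₁, hb₁, hw, Complex.conj_conj]
    exact ⟨rfl, rfl⟩
  | add p q hp hq =>
    simp only [map_add, hp.1, hp.2, hq.1, hq.2, and_self]

open MvPolynomial in
/-- The shape of an admissible system of parameters in eigencoordinates. -/
theorem exists_theta_form {h : ℕ} (h3 : 3 ≤ h) {ω : ℂ} (hω : IsPrimitiveRoot ω h)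
    (hb₀ : ∀ z y, b 0 (z ⊗ₜ y) = z * e y) (hb₁ : ∀ z y, b 1 (z ⊗ₜ y) = z * conj (e y))
    {c t : W} (hc : ∀ y, e ((c : E ≃ₗᵢ[ℝ] E) y) = ω * e y)
    (ht : ∀ y, e ((t : E ≃ₗᵢ[ℝ] E) y) = conj (e y))
    {θ : Fin 2 → MvPolynomial (Fin 2) ℂ} (hθ : IsAdmissibleHsop W b θ (h + 1)) :
    ∃ A B C' : ℂ, (B = 0 ∨ 2 * (h / 2) = h) ∧
      θ 0 = C A * X 0 ^ (h + 1) + C B * (X 0 ^ (h / 2 + 1) * X 1 ^ (h / 2)) +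
        C C' * (X 0 * X 1 ^ h) ∧
      θ 1 = C A * X 1 ^ (h + 1) + C B * (X 1 ^ (h / 2 + 1) * X 0 ^ (h / 2)) +
        C C' * (X 1 * X 0 ^ h) := by
  have hωc := (conj_eq_inv_of_pow (by omega) hω.pow_eq_one).2
  -- The contragredient action precomposes with the inverse, so `c⁻¹` acts on `V*` as pullback along
  -- `c`; likewise for `t⁻¹`.
  have hd0 : dualAct W c⁻¹ (b 0) = ω • b 0 := by
    ext v
    simp only [dualAct, inv_inv]
    simpa using (eigen_rotation hb₀ hb₁ hc (1 ⊗ₜ v)).1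
  have hd1 : dualAct W c⁻¹ (b 1) = ω⁻¹ • b 1 := by
    ext v
    simp only [dualAct, inv_inv]
    simpa [hωc] using (eigen_rotation hb₀ hb₁ hc (1 ⊗ₜ v)).2
  have ht0 : dualAct W t⁻¹ (b 0) = b 1 := by
    ext v
    simp only [dualAct, inv_inv]
    simpa using (eigen_reflection hb₀ hb₁ ht (1 ⊗ₜ v)).1
  have ht1 : dualAct W t⁻¹ (b 1) = b 0 := by
    ext v
    simp only [dualAct, inv_inv]
    simpa using (eigen_reflection hb₀ hb₁ ht (1 ⊗ₜ v)).2
  have hrot : aeval (fun i => C (![ω, ω⁻¹] i) * X i) (θ 0) = ω • θ 0 := by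
    have h1 := hθ.equivariant c⁻¹ (b 0)
    rw [hd0, map_smul, Module.Basis.constr_basis, polyAct] at h1
    rw [h1]
    congr 2
    ext1 i
    fin_cases i
    · simp [hd0, linearForm_apply_basis, smul_eq_C_mul]
    · simp [hd1, linearForm_apply_basis, smul_eq_C_mul]
  obtain ⟨A, B, C', hB, h0⟩ := eq_of_rotation_eigenvector h3 hω (hθ.homogeneous 0) hrot
  refine ⟨A, B, C', hB, h0, ?_⟩
  have h1 := hθ.equivariant t⁻¹ (b 0)
  rw [ht0, Module.Basis.constr_basis, Module.Basis.constr_basis, h0] at h1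
  rw [h1]
  simp [polyAct, ht0, ht1, linearForm_apply_basis, algebraMap_eq]

/-- The coefficients of a system of parameters are nondegenerate. -/
theorem theta_nondegenerate {h k : ℕ} (h0 : h ≠ 0) (hkh : k < h) (hk0 : k ≠ 0) {A B C : ℂ}
    (hzero : ∀ u w : ℂ, A * u ^ (h + 1) + B * (u ^ (k + 1) * w ^ k) + C * (u * w ^ h) = 0 →
      A * w ^ (h + 1) + B * (w ^ (k + 1) * u ^ k) + C * (w * u ^ h) = 0 → u = 0 ∧ w = 0) :
    A ≠ 0 ∧ A ≠ C ∧ ∀ η, η ^ h = 1 → A + C + B * η ^ k ≠ 0 := by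
  have hA : A ≠ 0 := by
    rintro rfl
    have := hzero 1 0 (by simp [h0, hk0]) (by simp)
    simp at this
  refine ⟨hA, ?_, ?_⟩
  · rintro rfl
    -- When `A = C`, the two forms take the values `u P(u)` and `P(u)` at `(u, 1)`, so a root of `P`
    -- gives a nonzero common zero.
    let P : Polynomial ℂ := Polynomial.C A * Polynomial.X ^ h +
      Polynomial.C B * Polynomial.X ^ k + Polynomial.C A
    have hcoeff : P.coeff h ≠ 0 := by
      simp [P, Polynomial.coeff_X_pow, Polynomial.coeff_C, h0, hA, hkh.ne']
    have hdeg : P.degree ≠ 0 := by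
      intro hd
      have h1 := Polynomial.le_degree_of_ne_zero hcoeff
      rw [hd] at h1
      exact h0 (by exact_mod_cast Nat.le_zero.1 (by exact_mod_cast h1))
    obtain ⟨u, hu⟩ := IsAlgClosed.exists_root P hdeg
    have hu' : A * u ^ h + B * u ^ k + A = 0 := by simpa [P] using hu
    have := hzero u 1 (by simp only [one_pow]; linear_combination u * hu')
      (by simp only [one_pow]; linear_combination hu')
    simp at this
  · intro η hη h1
    -- At `(η, 1)` the forms are `η` and `1` times `A + C + B η^k`.
    have := hzero η 1 (by rw [pow_succ η h, hη]; simp only [one_pow]; linear_combination η * h1)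
      (by rw [hη]; simp only [one_pow]; linear_combination h1)
    simp at this

open MvPolynomial in
theorem isReduced_of_theta_form {h k : ℕ} (h0 : h ≠ 0) (hk0 : k ≠ 0) {A B C' : ℂ}
    (hB : B = 0 ∨ 2 * k = h) (hAC : A ≠ C') {θ : Fin 2 → MvPolynomial (Fin 2) ℂ}
    (hθ₀ : θ 0 = C A * X 0 ^ (h + 1) + C B * (X 0 ^ (k + 1) * X 1 ^ k) + C C' * (X 0 * X 1 ^ h))
    (hθ₁ : θ 1 = C A * X 1 ^ (h + 1) + C B * (X 1 ^ (k + 1) * X 0 ^ k) + C C' * (X 1 * X 0 ^ h)) :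
    IsReduced (MvPolynomial (Fin 2) ℂ ⧸ deformedIdeal θ) := by
  refine isReduced_of_jacobian _ fun z hz => ?_
  have hz0 := hz 0
  have hz1 := hz 1
  rw [hθ₀] at hz0
  rw [hθ₁] at hz1
  simp only [map_sub, map_add, map_mul, map_pow, eval_C, eval_X, sub_eq_zero] at hz0 hz1
  have hsol := (solution_iff h0 hk0 hB hAC (z 0) (z 1)).1 ⟨hz0, hz1⟩
  rw [Matrix.det_fin_two]
  simp only [Matrix.of_apply]
  convert jacobian_ne_zero h0 hk0 hB hAC (z 0) (z 1) hsol using 1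
  have p00 : eval z (pderiv 0 (θ 0 - X 0)) =
      A * ((h + 1) * z 0 ^ h) + B * ((k + 1) * z 0 ^ k * z 1 ^ k) + C' * z 1 ^ h - 1 := by
    rw [hθ₀]
    simp [Derivation.leibniz, Derivation.leibniz_pow, pderiv_X]
    left
    ring
  have p11 : eval z (pderiv 1 (θ 1 - X 1)) =
      A * ((h + 1) * z 1 ^ h) + B * ((k + 1) * z 1 ^ k * z 0 ^ k) + C' * z 0 ^ h - 1 := by
    rw [hθ₁]
    simp [Derivation.leibniz, Derivation.leibniz_pow, pderiv_X]
    left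
    ring
  have p01 : eval z (pderiv 1 (θ 0 - X 0)) =
      B * (z 0 ^ (k + 1) * (k * z 1 ^ (k - 1))) + C' * (z 0 * (h * z 1 ^ (h - 1))) := by
    rw [hθ₀]
    simp [Derivation.leibniz, Derivation.leibniz_pow, pderiv_X]
  have p10 : eval z (pderiv 0 (θ 1 - X 1)) =
      B * (z 1 ^ (k + 1) * (k * z 0 ^ (k - 1))) + C' * (z 1 * (h * z 0 ^ (h - 1))) := by
    rw [hθ₁]
    simp [Derivation.leibniz, Derivation.leibniz_pow, pderiv_X]
  rw [p00, p11, p01, p10]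

end Eigencoordinates

/-! ### Noncrossing flats of dihedral groups -/

section Dihedral

open ComplexConjugate

variable {E : Type*} [NormedAddCommGroup E] [InnerProductSpace ℝ E]
  {W : Subgroup (E ≃ₗᵢ[ℝ] E)} {e : E ≃ₗᵢ[ℝ] ℂ}

theorem rotation_pow {c : W} {ω : ℂ} (hc : ∀ y, e ((c : E ≃ₗᵢ[ℝ] E) y) = ω * e y) (k : ℕ) (y : E) :
    e (((c ^ k : W) : E ≃ₗᵢ[ℝ] E) y) = ω ^ k * e y := by
  induction k generalizing y with
  | zero => simp
  | succ k ih => rw [pow_succ, Subgroup.coe_mul, isometry_mul_apply, ih, hc, pow_succ, mul_assoc]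

theorem rotation_pow_eq_one {c : W} {ω : ℂ} (hc : ∀ y, e ((c : E ≃ₗᵢ[ℝ] E) y) = ω * e y) {k : ℕ}
    (h : ω ^ k = 1) : c ^ k = 1 := by
  ext y
  apply e.injective
  rw [rotation_pow hc, h, one_mul]
  rfl

theorem rotation_pow_mul_reflection {c t : W} {ω : ℂ}
    (hc : ∀ y, e ((c : E ≃ₗᵢ[ℝ] E) y) = ω * e y)
    (ht : ∀ y, e ((t : E ≃ₗᵢ[ℝ] E) y) = conj (e y)) (k : ℕ) (y : E) :
    e (((c ^ k * t : W) : E ≃ₗᵢ[ℝ] E) y) = ω ^ k * conj (e y) := by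
  rw [Subgroup.coe_mul, isometry_mul_apply, rotation_pow hc, ht]

/-- When `‖η‖ = 1`, `η` is the square of a unit direction vector of the line, and `c` multiplies
directions by `ω`. -/
theorem image_line {c : W} {ω : ℂ} (hω : ω * conj ω = 1)
    (hc : ∀ y, e ((c : E ≃ₗᵢ[ℝ] E) y) = ω * e y) (η : ℂ) :
    image W c (line e η) = line e (ω ^ 2 * η) := by
  ext y
  obtain ⟨y, rfl⟩ := (c : E ≃ₗᵢ[ℝ] E).surjective y
  have hω0 : ω ≠ 0 := left_ne_zero_of_mul_eq_one hω
  rw [mem_image, LinearIsometryEquiv.symm_apply_apply, mem_line, mem_line, hc, map_mul]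
  have : ω ^ 2 * η * (conj ω * conj (e y)) = ω * (η * conj (e y)) := by
    linear_combination (ω * η * conj (e y)) * hω
  rw [this, mul_right_inj' hω0]

/-- The noncrossing flats of a dihedral group are the plane, the origin and all reflecting lines. -/
theorem noncrossing_classification {c t : W} {ω : ℂ} {h : ℕ} (h3 : 3 ≤ h)
    (hω : IsPrimitiveRoot ω h)
    (hc : ∀ y, e ((c : E ≃ₗᵢ[ℝ] E) y) = ω * e y)
    (ht : ∀ y, e ((t : E ≃ₗᵢ[ℝ] E) y) = conj (e y))
    (hall : ∀ w : W, ∃ k : ℕ, w = c ^ k ∨ w = c ^ k * t) :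
    (∀ X, IsNoncrossing W c X → X = ⊤ ∨ X = ⊥ ∨ ∃ η : ℂ, η ^ h = 1 ∧ X = line e η) ∧
      (IsNoncrossing W c ⊥ ∧ IsFlat W ⊥) ∧
      ∀ η : ℂ, η ^ h = 1 → IsNoncrossing W c (line e η) ∧ IsFlat W (line e η) := by
  have h0 : h ≠ 0 := by omega
  have hωk : ∀ k : ℕ, (ω ^ k) ^ h = 1 := fun k => by
    rw [← pow_mul, mul_comm, pow_mul, hω.pow_eq_one, one_pow]
  have hnorm : ∀ k : ℕ, ‖ω ^ k‖ = 1 := fun k => Complex.norm_eq_one_of_pow_eq_one (hωk k) h0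
  have hrot : ∀ k : ℕ, ω ^ k ≠ 1 → fixedSpace W (c ^ k) = ⊥ := by
    intro k hk
    rw [Submodule.eq_bot_iff]
    intro y hy
    have h1 : e (((c ^ k : W) : E ≃ₗᵢ[ℝ] E) y) = e y := congrArg e hy
    rw [rotation_pow hc] at h1
    have h2 : (ω ^ k - 1) * e y = 0 := by linear_combination h1
    have h4 := (mul_eq_zero.1 h2).resolve_left (sub_ne_zero.2 hk)
    simpa using h4
  have hrefl : ∀ k : ℕ, fixedSpace W (c ^ k * t) = line e (ω ^ k) := by
    intro k
    ext y
    rw [mem_line, ← rotation_pow_mul_reflection hc ht]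
    exact eq_comm.trans e.injective.eq_iff.symm
  have hisrefl : ∀ k : ℕ, IsReflection W (c ^ k * t) ∧ IsFlat W (line e (ω ^ k)) := by
    intro k
    obtain ⟨α, hα, h1, h2⟩ := exists_root_of_reflection e (hnorm k)
      (rotation_pow_mul_reflection hc ht k)
    exact ⟨⟨α, hα, h1⟩, h2 ▸ isFlat_hyperplane hα⟩
  have hω1 : ω ^ 1 ≠ 1 := by
    rw [pow_one]
    exact hω.ne_one (by omega)
  -- Every reflection lies below `c`: its cofactor reverses orientation and so is a reflection too,
  -- while `c` has length 2 because `c² ≠ 1`.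
  have hNCline : ∀ k : ℕ, IsNoncrossing W c (line e (ω ^ k)) := by
    intro k
    refine ⟨c ^ k * t, ?_, (hrefl k).symm⟩
    have hr := (hisrefl k).1
    obtain ⟨j, hj⟩ := hall ((c ^ k * t)⁻¹ * c)
    have hsplit : c = (c ^ k * t) * ((c ^ k * t)⁻¹ * c) := by group
    have hother : IsReflection W ((c ^ k * t)⁻¹ * c) := by
      rcases hj with hj | hj
      -- Otherwise `c` would be both a rotation and orientation-reversing; its values at `1` and `I`
      -- refute this.
      · exfalso
        rw [hj] at hsplit
        have h1 : e (((c : W) : E ≃ₗᵢ[ℝ] E) (e.symm 1)) =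
            e (((c ^ k * t * c ^ j : W) : E ≃ₗᵢ[ℝ] E) (e.symm 1)) := by rw [← hsplit]
        have h2 : e (((c : W) : E ≃ₗᵢ[ℝ] E) (e.symm Complex.I)) =
            e (((c ^ k * t * c ^ j : W) : E ≃ₗᵢ[ℝ] E) (e.symm Complex.I)) := by rw [← hsplit]
        rw [Subgroup.coe_mul, isometry_mul_apply, rotation_pow_mul_reflection hc ht,
          rotation_pow hc, hc, LinearIsometryEquiv.apply_symm_apply] at h1 h2
        simp only [map_mul, mul_one, Complex.conj_I] at h1 h2
        have h4 : ω * Complex.I = 0 := by linear_combination (h2 + Complex.I * h1) / 2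
        exact mul_ne_zero (hω.ne_zero h0) Complex.I_ne_zero h4
      · rw [hj]
        exact (hisrefl j).1
    have hsq : c * c ≠ 1 := by
      intro h1
      have h2 := rotation_pow hc 2 (e.symm 1)
      rw [pow_two c, h1] at h2
      have h4 : ω ^ 2 = 1 := by simpa using h2.symm
      have := Nat.le_of_dvd (by norm_num) (hω.dvd_of_pow_eq_one 2 h4)
      omega
    rw [AbsLE, hr.reflectionLength W, hother.reflectionLength W]
    have := reflectionLength_mul W hr hother (by rwa [← hsplit])
    rwa [← hsplit] at this
  have : NeZero h := ⟨h0⟩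
  refine ⟨?_, ⟨?_, ?_⟩, ?_⟩
  · rintro X ⟨u, -, rfl⟩
    obtain ⟨k, rfl | rfl⟩ := hall u
    · by_cases hk : ω ^ k = 1
      · left
        rw [rotation_pow_eq_one hc hk]
        ext
        simp [fixedSpace]
      · exact Or.inr (Or.inl (hrot k hk))
    · exact Or.inr (Or.inr ⟨ω ^ k, hωk k, hrefl k⟩)
  · have h1 := isNoncrossing_fixedSpace_self W c
    have h2 := hrot 1 hω1
    rw [pow_one] at h2
    rwa [h2] at h1
  · have h1 := (hisrefl 0).2.inf (hisrefl 1).2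
    have h2 : line e (ω ^ 0) ⊓ line e (ω ^ 1) = ⊥ := by
      rw [Submodule.eq_bot_iff]
      rintro y ⟨hy0, hy1⟩
      by_contra hy
      exact hω1 (by rw [← eq_of_mem_line e hy hy0 hy1, pow_zero])
    rwa [h2] at h1
  · intro η hη
    obtain ⟨k, -, rfl⟩ := hω.eq_pow_of_pow_eq_one hη
    exact ⟨hNCline k, (hisrefl k).2⟩

/-- If `B ≠ 0` then `ω^(2k) = ω^h = 1`. Besides constancy on `c`-orbits, this also yields `B η^(-k)
= B η^k`, by taking `η` itself as the root of unity. -/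
theorem pow_half_mul_eq {h k : ℕ} {B ω η : ℂ} (hB : B = 0 ∨ 2 * k = h) (hω : ω ^ h = 1) :
    B * (ω ^ 2 * η) ^ k = B * η ^ k := by
  rcases hB with rfl | rfl
  · simp
  · rw [mul_pow, ← pow_mul, hω, one_mul]

end Dihedral

/-! ### The equivariant bijection in rank two -/

section MainTheorem

open ComplexConjugate

variable {E : Type*} [NormedAddCommGroup E] [InnerProductSpace ℝ E] [FiniteDimensional ℝ E]
  {W : Subgroup (E ≃ₗᵢ[ℝ] E)} {e : E ≃ₗᵢ[ℝ] ℂ}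
  {b : Module.Basis (Fin 2) ℂ (Module.Dual ℂ (ℂ ⊗[ℝ] E))}

open Classical in
/-- The points of `V^Θ` attached to the noncrossing flats of a dihedral group, in eigencoordinates:
`y` selects the scaling on each reflecting line. -/
noncomputable def flatPoint (e : E ≃ₗᵢ[ℝ] ℂ)
    (b : Module.Basis (Fin 2) ℂ (Module.Dual ℂ (ℂ ⊗[ℝ] E))) (a : ℂ) (y : ℂ → ℂ)
    (X : Submodule ℝ E) : ℂ ⊗[ℝ] E :=
  if X = ⊤ then (coords b).symm ![0, a]
  else if h : ∃ η : ℂ, ‖η‖ = 1 ∧ X = line e η then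
    (coords b).symm ![h.choose * y h.choose, y h.choose]
  else 0

theorem flatPoint_top (a : ℂ) (y : ℂ → ℂ) :
    b 0 (flatPoint e b a y ⊤) = 0 ∧ b 1 (flatPoint e b a y ⊤) = a := by
  rw [flatPoint, if_pos rfl]
  exact ⟨coords_symm_apply b _ 0, coords_symm_apply b _ 1⟩

theorem flatPoint_bot [Nontrivial E] (a : ℂ) (y : ℂ → ℂ) : flatPoint e b a y ⊥ = 0 := by
  rw [flatPoint, if_neg bot_ne_top, dif_neg]
  rintro ⟨η, hη, h⟩
  exact line_ne_bot e hη h.symm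

theorem flatPoint_line (a : ℂ) (y : ℂ → ℂ) {η : ℂ} (hη : ‖η‖ = 1) :
    b 0 (flatPoint e b a y (line e η)) = η * y η ∧ b 1 (flatPoint e b a y (line e η)) = y η := by
  have h : ∃ η' : ℂ, ‖η'‖ = 1 ∧ line e η = line e η' := ⟨η, hη, rfl⟩
  have h1 : h.choose = η := (line_injective e hη h.choose_spec.2).symm
  rw [flatPoint, if_neg (line_ne_top e hη), dif_pos h, h1]
  exact ⟨coords_symm_apply b _ 0, coords_symm_apply b _ 1⟩

theorem mainTheorem_eigencoordinates [Nontrivial E] {c t : W} {h : ℕ} (hh : orderOf c = h)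
    (h3 : 3 ≤ h)
    (hb₀ : ∀ z y, b 0 (z ⊗ₜ y) = z * e y) (hb₁ : ∀ z y, b 1 (z ⊗ₜ y) = z * conj (e y))
    (hc : ∀ y, e ((c : E ≃ₗᵢ[ℝ] E) y) = omega W c * e y)
    (ht : ∀ y, e ((t : E ≃ₗᵢ[ℝ] E) y) = conj (e y))
    (hall : ∀ w : W, ∃ k : ℕ, w = c ^ k ∨ w = c ^ k * t)
    {θ : Fin 2 → MvPolynomial (Fin 2) ℂ} (hθ : IsAdmissibleHsop W b θ (h + 1)) :
    (variety b θ).encard = (((h + 1) ^ 2 : ℕ) : ℕ∞) ∧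
    IsReduced (MvPolynomial (Fin 2) ℂ ⧸ deformedIdeal θ) ∧
    ∃ f : parkNC W c ≃ variety b θ,
      ∀ (w : W) (d : ℤ) (p : parkNC W c),
        (f ((w, (⟨c ^ d, d, rfl⟩ : Subgroup.zpowers c)) • p) : ℂ ⊗[ℝ] E) =
          omega W c ^ d • complexAct W w (f p : ℂ ⊗[ℝ] E) := by
  have h0 : h ≠ 0 := by omega
  have hω : IsPrimitiveRoot (omega W c) h := by
    rw [omega, hh]
    exact Complex.isPrimitiveRoot_exp h h0
  obtain ⟨A, B, C, hB, hθ₀, hθ₁⟩ := exists_theta_form h3 hω hb₀ hb₁ hc ht hθ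
  set ω := omega W c with hωdef
  set k := h / 2 with hk
  have hk0 : k ≠ 0 := by omega
  have hkh : k < h := by omega
  have heval₀ : ∀ z : Fin 2 → ℂ, MvPolynomial.eval z (θ 0) =
      A * z 0 ^ (h + 1) + B * (z 0 ^ (k + 1) * z 1 ^ k) + C * (z 0 * z 1 ^ h) := fun z => by
    rw [hθ₀]; simp
  have heval₁ : ∀ z : Fin 2 → ℂ, MvPolynomial.eval z (θ 1) =
      A * z 1 ^ (h + 1) + B * (z 1 ^ (k + 1) * z 0 ^ k) + C * (z 1 * z 0 ^ h) := fun z => by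
    rw [hθ₁]; simp
  obtain ⟨hA, hAC, hABC⟩ := theta_nondegenerate h0 hkh hk0 (A := A) (B := B) (C := C) fun u w h1 h2 => by
    have h4 := hθ.eq_zero W b ![u, w] (by
      rw [Fin.forall_fin_two, heval₀, heval₁]
      exact ⟨h1, h2⟩)
    exact ⟨congrFun h4 0, congrFun h4 1⟩
  have hmem : ∀ v, v ∈ variety b θ ↔ (b 0 v = 0 ∧ b 1 v = 0) ∨ (b 1 v = 0 ∧ A * b 0 v ^ h = 1) ∨
      (b 0 v = 0 ∧ A * b 1 v ^ h = 1) ∨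
        ∃ η : ℂ, η ^ h = 1 ∧ b 0 v = η * b 1 v ∧ (A + C + B * η ^ k) * b 1 v ^ h = 1 := fun v => by
    rw [mem_variety_iff, Fin.forall_fin_two, evalAt, evalAt, heval₀, heval₁,
      solution_iff h0 hk0 hB hAC]
  refine ⟨?_, isReduced_of_theta_form h0 hk0 hB hAC hθ₀ hθ₁, ?_⟩
  · rw [← (coords b).injective.encard_image]
    refine encard_solutions h0 hω hA hABC _ fun z => ?_
    have h1 : z ∈ coords b '' variety b θ ↔ (coords b).symm z ∈ variety b θ := by
      rw [← Set.mem_preimage, LinearEquiv.image_eq_preimage_symm]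
    rw [h1, hmem, coords_symm_apply, coords_symm_apply]
  · have hroot : ∀ r : ℂ, ∃ a : ℂ, r ≠ 0 → r * a ^ h = 1 := fun r => by
      obtain ⟨a, ha⟩ := IsAlgClosed.exists_pow_nat_eq r⁻¹ (Nat.pos_of_ne_zero h0)
      exact ⟨a, fun hr => by rw [ha, mul_inv_cancel₀ hr]⟩
    choose Y hY using hroot
    have hY0 : ∀ r, r ≠ 0 → Y r ≠ 0 := fun r hr h1 => by
      have := hY r hr
      simp [h1, h0] at this
    have hω0 : ω ≠ 0 := hω.ne_zero h0
    have hωj : ∀ j : ℕ, (ω ^ j) ^ h = 1 := fun j => by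
      rw [← pow_mul, mul_comm, pow_mul, hω.pow_eq_one, one_pow]
    have hconj : conj ω = ω⁻¹ := (conj_eq_inv_of_pow h0 hω.pow_eq_one).2
    have hη1 : ∀ {η : ℂ}, η ^ h = 1 → ‖η‖ = 1 := fun hη => (conj_eq_inv_of_pow h0 hη).1
    obtain ⟨hNC, hbot, hline⟩ := noncrossing_classification h3 hω hc ht hall
    set a := Y A with ha
    have ha0 : a ≠ 0 := hY0 A hA
    -- The root is chosen as a function of the coefficient, not of `η`, so lines in one `c`-orbit
    -- automatically get the same scaling.
    set y : ℂ → ℂ := fun η => Y (A + C + B * η ^ k) with hy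
    have hyη : ∀ {η : ℂ}, η ^ h = 1 → (A + C + B * η ^ k) * y η ^ h = 1 := fun hη => hY _ (hABC _ hη)
    have hy0 : ∀ {η : ℂ}, η ^ h = 1 → y η ≠ 0 := fun hη => hY0 _ (hABC _ hη)
    have hyω : ∀ (j : ℕ) (η : ℂ), y ((ω ^ j) ^ 2 * η) = y η := fun j η => by
      rw [hy]
      dsimp only
      rw [pow_half_mul_eq hB (hωj j)]
    have hyω1 : ∀ η : ℂ, y (ω ^ 2 * η) = y η := fun η => by simpa using hyω 1 η
    have hrot : ∀ (j : ℕ) v, b 0 (complexAct W (c ^ j) v) = ω ^ j * b 0 v ∧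
        b 1 (complexAct W (c ^ j) v) = (ω ^ j)⁻¹ * b 1 v := fun j v => by
      have := eigen_rotation hb₀ hb₁ (rotation_pow hc j) v
      rwa [map_pow, hconj, inv_pow] at this
    have hrefl : ∀ (j : ℕ) v, b 0 (complexAct W (c ^ j * t) v) = ω ^ j * b 1 v ∧
        b 1 (complexAct W (c ^ j * t) v) = (ω ^ j)⁻¹ * b 0 v := fun j v => by
      have h1 := eigen_reflection hb₀ hb₁ ht v
      rw [complexAct_mul, (hrot j _).1, (hrot j _).2, h1.1, h1.2]
      exact ⟨rfl, rfl⟩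
    have hc1 : ∀ v, b 0 (complexAct W c v) = ω * b 0 v ∧ b 1 (complexAct W c v) = ω⁻¹ * b 1 v :=
      fun v => by simpa using hrot 1 v
    have hext : ∀ {v v' : ℂ ⊗[ℝ] E}, b 0 v = b 0 v' → b 1 v = b 1 v' → v = v' := fun h1 h2 =>
      basis_ext b (Fin.forall_fin_two.2 ⟨h1, h2⟩)
    have hωj0 : ∀ j : ℕ, ω ^ j ≠ 0 := fun j => pow_ne_zero _ hω0
    have hP := fun {η : ℂ} (hη : η ^ h = 1) => flatPoint_line (e := e) (b := b) a y (hη1 hη)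
    obtain ⟨hT0, hT1⟩ := flatPoint_top (e := e) (b := b) a y
    have hZ := flatPoint_bot (e := e) (b := b) a y
    refine exists_equivariant_equiv W c _ (flatPoint e b a y) ?_ ?_ ?_ ?_ ?_
    · intro X hX
      rw [← hωdef]
      rcases hNC X hX with rfl | rfl | ⟨η, hη, rfl⟩
      · have h1 : image W c ⊤ = ⊤ := by ext; simp [mem_image]
        rw [h1]
        apply hext
        · rw [map_smul, (hc1 _).1, hT0]
          simp
        · rw [map_smul, (hc1 _).2, hT1, smul_eq_mul, mul_inv_cancel_left₀ hω0]
      · have h1 : image W c ⊥ = ⊥ := by ext; simp [mem_image]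
        rw [h1, hZ]
        simp
      · have hη' : (ω ^ 2 * η) ^ h = 1 := by rw [mul_pow, hωj, hη, one_mul]
        rw [image_line (by rw [hconj, mul_inv_cancel₀ hω0]) hc]
        apply hext
        · rw [map_smul, (hc1 _).1, (hP hη').1, (hP hη).1, hyω1, smul_eq_mul]
          ring
        · rw [map_smul, (hc1 _).2, (hP hη').2, (hP hη).2, hyω1, smul_eq_mul,
            mul_inv_cancel_left₀ hω0]
    · intro X hX w hw
      rcases hNC X hX with rfl | rfl | ⟨η, hη, rfl⟩
      · obtain rfl : w = 1 := by
          ext z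
          exact hw z trivial
        exact complexAct_one W _
      · rw [hZ, map_zero]
      · obtain ⟨z, hz, hz0⟩ := exists_mem_line e (hη1 hη)
        have h1 := congrArg e (hw z hz)
        obtain ⟨j, rfl | rfl⟩ := hall w
        · rw [rotation_pow hc] at h1
          have h2 : ω ^ j = 1 := by
            refine mul_right_cancel₀ (b := e z) (by simpa using hz0) (by rw [h1, one_mul])
          rw [rotation_pow_eq_one hc h2, complexAct_one]
        · rw [rotation_pow_mul_reflection hc ht] at h1
          obtain rfl := eq_of_mem_line e hz0 hz h1.symm
          apply hext
          · rw [(hrefl _ _).1, (hP hη).1, (hP hη).2]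
          · rw [(hrefl _ _).2, (hP hη).1, (hP hη).2, inv_mul_cancel_left₀ (hωj0 j)]
    · intro X X' hX hX' w hww
      have e0 := congrArg (b 0) hww
      have e1 := congrArg (b 1) hww
      have hne : ∀ {η : ℂ}, η ^ h = 1 → η ≠ 0 := fun hη => by
        rintro rfl
        simp [h0] at hη
      -- Elements of `W` scale or swap the coordinates, so the number of vanishing coordinates (one,
      -- two or none) tells the plane, the origin and the lines apart.
      rcases hNC X hX with rfl | rfl | ⟨η, hη, rfl⟩ <;>
        rcases hNC X' hX' with rfl | rfl | ⟨η', hη', rfl⟩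
      · refine ⟨rfl, ?_⟩
        obtain ⟨j, rfl | rfl⟩ := hall w
        · rw [(hrot _ _).2, hT1] at e1
          have h1 : (ω ^ j)⁻¹ = 1 := mul_right_cancel₀ ha0 (by rw [e1, one_mul])
          rw [rotation_pow_eq_one hc (inv_eq_one.1 h1)]
          exact one_mem _
        · rw [(hrefl _ _).2, hT0, hT1, mul_zero] at e1
          exact (ha0 e1.symm).elim
      · exfalso
        rw [hZ, map_zero (b 0)] at e0
        rw [hZ, map_zero (b 1)] at e1
        obtain ⟨j, rfl | rfl⟩ := hall w
        · rw [(hrot _ _).2, hT1] at e1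
          simp [ha0, hω0] at e1
        · rw [(hrefl _ _).1, hT1] at e0
          simp [ha0, hω0] at e0
      · exfalso
        rw [(hP hη').1] at e0
        rw [(hP hη').2] at e1
        obtain ⟨j, rfl | rfl⟩ := hall w
        · rw [(hrot _ _).1, hT0, mul_zero] at e0
          exact mul_ne_zero (hne hη') (hy0 hη') e0.symm
        · rw [(hrefl _ _).2, hT0, mul_zero] at e1
          exact hy0 hη' e1.symm
      · rw [hZ, map_zero, map_zero, hT1] at e1
        exact (ha0 e1.symm).elim
      · refine ⟨rfl, fun z hz => ?_⟩
        rw [(Submodule.mem_bot ℝ).1 hz, map_zero]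
      · rw [hZ, map_zero, map_zero, (hP hη').2] at e1
        exact (hy0 hη' e1.symm).elim
      · exfalso
        rw [hT0] at e0
        obtain ⟨j, rfl | rfl⟩ := hall w
        · rw [(hrot _ _).1, (hP hη).1] at e0
          exact mul_ne_zero (hωj0 j) (mul_ne_zero (hne hη) (hy0 hη)) e0
        · rw [(hrefl _ _).1, (hP hη).2] at e0
          exact mul_ne_zero (hωj0 j) (hy0 hη) e0
      · exfalso
        rw [hZ, map_zero (b 0)] at e0
        obtain ⟨j, rfl | rfl⟩ := hall w
        · rw [(hrot _ _).1, (hP hη).1] at e0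
          exact mul_ne_zero (hωj0 j) (mul_ne_zero (hne hη) (hy0 hη)) e0
        · rw [(hrefl _ _).1, (hP hη).2] at e0
          exact mul_ne_zero (hωj0 j) (hy0 hη) e0
      · rw [(hP hη').1] at e0
        rw [(hP hη').2] at e1
        obtain ⟨j, rfl | rfl⟩ := hall w
        · rw [(hrot _ _).1, (hP hη).1] at e0
          rw [(hrot _ _).2, (hP hη).2] at e1
          have h1 : y η = ω ^ j * y η' := by rw [← e1, mul_inv_cancel_left₀ (hωj0 j)]
          have h2 : (ω ^ j) ^ 2 * η = η' := by
            refine mul_right_cancel₀ (hy0 hη') ?_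
            rw [← e0, h1]
            ring
          have h4 : y η' = y η := by rw [← h2, hyω]
          have h5 : ω ^ j = 1 := mul_right_cancel₀ (hy0 hη) (by rw [one_mul, ← h4, ← h1, h4])
          rw [rotation_pow_eq_one hc h5]
          rw [h5, one_pow, one_mul] at h2
          exact ⟨by rw [h2], one_mem _⟩
        · rw [(hrefl _ _).1, (hP hη).2] at e0
          rw [(hrefl _ _).2, (hP hη).1] at e1
          have h1 : η * y η = ω ^ j * y η' := by rw [← e1, mul_inv_cancel_left₀ (hωj0 j)]
          -- The reflection `c ^ j * t` takes the line of `η` to that of `ω^(2j) η⁻¹ = η'`. The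
          -- scalings then agree, which forces `ω^j = η = η'`: it is the reflection fixing the line.
          have h2 : (ω ^ j) ^ 2 = η * η' := by
            refine mul_right_cancel₀ (mul_ne_zero (hy0 hη) (hy0 hη')) ?_
            linear_combination ω ^ j * y η' * e0 - η' * y η' * h1
          have h4 : y η' = y η := by
            rw [← hyω j η', h2]
            have h6 : B * (η * η' * η') ^ k = B * η ^ k := by
              rw [mul_assoc, ← pow_two, mul_comm η, pow_half_mul_eq hB hη']
            rw [hy]
            dsimp only
            rw [h6]
          have h5 : ω ^ j = η := by
            rw [h4] at h1
            exact (mul_right_cancel₀ (hy0 hη) h1).symm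
          have h6 : η = η' := by
            rw [h5, pow_two] at h2
            exact mul_left_cancel₀ (hne hη) h2
          refine ⟨by rw [h6], fun z hz => e.injective ?_⟩
          rw [rotation_pow_mul_reflection hc ht, h5]
          exact hz.symm
    · intro X hX w
      rw [hmem]
      rcases hNC X hX with rfl | rfl | ⟨η, hη, rfl⟩
      · obtain ⟨j, rfl | rfl⟩ := hall w
        · right; right; left
          rw [(hrot _ _).1, (hrot _ _).2, hT0, hT1, mul_pow, inv_pow, hωj, inv_one, one_mul]
          exact ⟨mul_zero _, hY A hA⟩
        · right; left
          rw [(hrefl _ _).1, (hrefl _ _).2, hT0, hT1, mul_pow, hωj, one_mul]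
          exact ⟨mul_zero _, hY A hA⟩
      · left
        rw [hZ]
        simp
      · right; right; right
        obtain ⟨j, rfl | rfl⟩ := hall w
        · rw [(hrot _ _).1, (hrot _ _).2, (hP hη).1, (hP hη).2]
          refine ⟨(ω ^ j) ^ 2 * η, by rw [mul_pow, ← pow_mul, mul_comm 2, pow_mul, hωj, hη]; simp,
            ?_, ?_⟩
          · field_simp
          · rw [pow_half_mul_eq hB (hωj j), mul_pow, inv_pow, hωj, inv_one, one_mul, hyη hη]
        · rw [(hrefl _ _).1, (hrefl _ _).2, (hP hη).1, (hP hη).2]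
          have hη0 : η ≠ 0 := by
            rintro rfl
            simp [h0] at hη
          refine ⟨(ω ^ j) ^ 2 * η⁻¹, ?_, ?_, ?_⟩
          · rw [mul_pow, ← pow_mul, mul_comm 2, pow_mul, hωj, inv_pow, hη]
            simp
          · field_simp
          · have h1 : B * (η⁻¹) ^ k = B * η ^ k := by
              rw [← pow_half_mul_eq (η := η⁻¹) hB hη, pow_two, mul_assoc, mul_inv_cancel₀ hη0,
                mul_one]
            rw [pow_half_mul_eq hB (hωj j), h1, mul_pow, mul_pow, inv_pow, hωj, hη, inv_one,
              one_mul, one_mul, hyη hη]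
    · intro v hv
      rcases (hmem v).1 hv with ⟨h1, h2⟩ | ⟨h1, h2⟩ | ⟨h1, h2⟩ | ⟨η, hη, h1, h2⟩
      · refine ⟨1, ⊥, hbot.2, hbot.1, ?_⟩
        rw [hZ, map_zero]
        exact hext (by simpa using h1) (by simpa using h2)
      -- The base point `(0, a)` lies on the other axis, so points of this axis are reached by
      -- reflections.
      · obtain ⟨j, -, hj⟩ := exists_pow_mul_of_pow_eq h0 hω (hY A hA) h2
        refine ⟨c ^ j * t, ⊤, isFlat_top W, isNoncrossing_top W c, hext ?_ ?_⟩
        · rw [(hrefl _ _).1, hT1, hj]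
        · rw [(hrefl _ _).2, hT0, h1, mul_zero]
      -- Here `ω⁻¹` is the primitive root to use, as `c` acts by it on the second coordinate.
      · obtain ⟨j, -, hj⟩ := exists_pow_mul_of_pow_eq h0 hω.inv (hY A hA) h2
        refine ⟨c ^ j, ⊤, isFlat_top W, isNoncrossing_top W c, hext ?_ ?_⟩
        · rw [(hrot _ _).1, hT0, h1, mul_zero]
        · rw [(hrot _ _).2, hT1, hj, inv_pow]
      · obtain ⟨j, -, hj⟩ := exists_pow_mul_of_pow_eq h0 hω.inv (hyη hη) h2
        -- The parameter of the line that `c ^ j` carries to the line of `η`.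
        set η₁ := ((ω ^ j) ^ 2)⁻¹ * η with hη₁
        have e1 : (ω ^ j) ^ 2 * η₁ = η := by
          rw [hη₁, mul_inv_cancel_left₀ (pow_ne_zero _ (hωj0 j))]
        have hη₁' : η₁ ^ h = 1 := by
          rw [hη₁, mul_pow, inv_pow, ← pow_mul, mul_comm 2, pow_mul, hωj, hη]
          simp
        have e2 : y η₁ = y η := by rw [← e1, hyω]
        obtain ⟨g1, g2⟩ := hline η₁ hη₁'
        refine ⟨c ^ j, line e η₁, g2, g1, hext ?_ ?_⟩
        · rw [(hrot _ _).1, (hP hη₁').1, e2, h1, hj, inv_pow]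
          rw [← e1]
          have := hωj0 j
          field_simp
        · rw [(hrot _ _).2, (hP hη₁').2, e2, hj, inv_pow]

theorem mainTheorem_rank_two (hE : Module.finrank ℝ E = 2)
    (hW : IsIrreducibleReflectionGroup W) (c : W) (hc : IsCoxeterElement W c)
    (x : Module.Basis (Fin 2) ℂ (Module.Dual ℂ (ℂ ⊗[ℝ] E)))
    (θ : Fin 2 → MvPolynomial (Fin 2) ℂ) (hθ : IsAdmissibleHsop W x θ (orderOf c + 1)) :
    (variety x θ).encard = (((orderOf c + 1) ^ 2 : ℕ) : ℕ∞) ∧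
    IsReduced (MvPolynomial (Fin 2) ℂ ⧸ deformedIdeal θ) ∧
    ∃ f : parkNC W c ≃ variety x θ,
      ∀ (w : W) (d : ℤ) (p : parkNC W c),
        (f ((w, (⟨c ^ d, d, rfl⟩ : Subgroup.zpowers c)) • p) : ℂ ⊗[ℝ] E) =
          omega W c ^ d • complexAct W w (f p : ℂ ⊗[ℝ] E) := by
  have := hW.space_nontrivial
  obtain ⟨h3, e, t, hce, ht, hall⟩ := exists_dihedral_form hE hW hc
  obtain ⟨b, hb₀, hb₁⟩ := exists_eigenBasis e hE
  obtain ⟨h1, h2, h4⟩ := mainTheorem_eigencoordinates rfl h3 hb₀ hb₁ hce ht hall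
    (hθ.change W x b)
  -- The zero locus is the same subset of `V` in either basis, so the count and the bijection carry
  -- over unchanged.
  rw [variety_changeHsop] at h1 h4
  exact ⟨h1, isReduced_of_changeHsop x b θ h2, h4⟩

end MainTheorem

end ParkingSpace

theorem mainTheorem6 {E : Type*} [NormedAddCommGroup E] [InnerProductSpace ℝ E]
    [FiniteDimensional ℝ E] {n : ℕ} (hn : Module.finrank ℝ E = n) (hn2 : n ≤ 2)
    (W : Subgroup (E ≃ₗᵢ[ℝ] E)) (hW : ParkingSpace.IsIrreducibleReflectionGroup W)
    (c : W) (hc : ParkingSpace.IsCoxeterElement W c)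
    (x : Module.Basis (Fin n) ℂ (Module.Dual ℂ (ℂ ⊗[ℝ] E)))
    (θ : Fin n → MvPolynomial (Fin n) ℂ)
    (hθ : ParkingSpace.IsAdmissibleHsop W x θ (orderOf c + 1)) :
    (ParkingSpace.variety x θ).encard = (((orderOf c + 1) ^ n : ℕ) : ℕ∞) ∧
    IsReduced (MvPolynomial (Fin n) ℂ ⧸ ParkingSpace.deformedIdeal θ) ∧
    ∃ f : ParkingSpace.parkNC W c ≃ ParkingSpace.variety x θ,
      ∀ (w : W) (d : ℤ) (p : ParkingSpace.parkNC W c),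
        (f ((w, (⟨c ^ d, d, rfl⟩ : Subgroup.zpowers c)) • p) : ℂ ⊗[ℝ] E) =
          ParkingSpace.omega W c ^ d • ParkingSpace.complexAct W w (f p : ℂ ⊗[ℝ] E) := by
  have := hW.space_nontrivial
  have hpos : 0 < n := hn ▸ Module.finrank_pos
  obtain rfl | rfl : n = 1 ∨ n = 2 := by omega
  · exact ParkingSpace.mainTheorem_rank_one hn hW c hc x θ hθ
  · exact ParkingSpace.mainTheorem_rank_two hn hW c hc x θ hθ
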